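/- **Setting.** Let $A\in\mathbb{Q}^{n\times n}$ be expanding (all complex eigenvalues have modulus $>1$), $B=A^{-1}$, and let $\mathbb{Z}^n[A]=\sum_{k\ge 0}A^k\mathbb{Z}^n$, $\mathbb{Z}^n[B]=\sum_{k\ge 0}B^k\mathbb{Z}^n$, $\mathbb{Z}^n(B)=\sum_{k\in\mathbb{Z}}B^k\mathbb{Z}^n$. Put $a=|\mathbb{Z}^n[A]/A\mathbb{Z}^n[A]|$ and $b=|\mathbb{Z}^n[B]/B\mathbb{Z}^n[B]|$, and assume $b\ge 2$. For $y\in\mathbb{Z}^n(B)$ let $\nu(y)$ be the integer $k$ with $y\in B^k\mathbb{Z}^n[B]\setminus B^{k+1}\mathbb{Z}^n[B]$, and $\nu(y)=\infty$ if there is none. Let $\mathbb{Z}^n((B))$ be the (Hausdorff) completion of $\mathbb{Z}^n(B)$ for the pseudometric $\mathbf{d}_B(y,y')=b^{-\nu(y-y')}$ (with $b^{-\infty}=0$), and let $\mathbb{Z}^n[[B]]$ be its closed unit ball. The representation space is $\mathbb{K}_A=\mathbb{R}^n\times\mathbb{Z}^n((B))$, with the maximum of the Euclidean and the $B$-adic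 metric, with the Haar measure $\mu=\lambda\times\mu_B$, where $\lambda$ is Lebesgue measure and $\mu_B$ is the Haar measure with $\mu_B(\mathbb{Z}^n[[B]])=1$, and with the action $A(x,y)=(Ax,Ay)$. Let $\varphi:\mathbb{Z}^n(B)\to\mathbb{K}_A$, $\varphi(x)=(x,x)$. Let $\mathcal{D}\subset\mathbb{Z}^n[A]$ be a digit set, that is, $|\mathcal{D}|=a$, and let $\mathcal{F}\subset\mathbb{K}_A$ be the unique nonempty compact set with $A\mathcal{F}=\bigcup_{d\in\mathcal{D}}(\mathcal{F}+\varphi(d))$. For $k\ge 1$ let $\mathcal{D}_k=\{d_0+Ad_1+\dots+A^{k-1}d_{k-1}\mid d_0,\dots,d_{k-1}\in\mathcal{D}\}$, and let $\Delta=\bigcup_{k\ge 1}\varphi(\mathcal{D}_k-\mathcal{D}_k)$. For $\mathcal{S}\subset\mathbb{K}_A$, the collection $\mathcal{F}+\mathcal{S}=\{\mathcal{F}+s\mid s\in\mathcal{S}\}$ is a *tiling* of $\mathbb{K}_A$ if it covers $\mathbb{K}_A$ and $\mu((\mathcal{F}+s)\cap(\mathcal{F}+s'))=0$ for all $s\ne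 s'$ in $\mathcal{S}$. A tiling $\mathcal{F}+\mathcal{S}$ is *self-replicating*, with associated map $T$, if $T$ is an expanding linear map of $\mathbb{K}_A$ and for each $s\in\mathcal{S}$ there is a finite $J(s)\subset\mathcal{S}$ with $T(\mathcal{F}+s)=\bigcup_{s'\in J(s)}(\mathcal{F}+s')$. Here an expanding linear map is a continuous additive bijection $T$ that commutes with the action of $A$ and for which there are $c>0$, $r>1$ with $\mathbf{d}(T^mp,T^mq)\ge c\,r^m\,\mathbf{d}(p,q)$ for all $m\ge 0$ and $p,q\in\mathbb{K}_A$. The tiling is *atomic* if the origin lies in exactly one of the tiles $\mathcal{F}+s$, $s\in\mathcal{S}$. **Theorem.** Suppose that $\mathcal{F}$ contains a nonempty open set. Then: (i) There is a set $\mathcal{S}\subset\Delta$ such that $\mathcal{F}+\mathcal{S}$ is a tiling of $\mathbb{K}_A$. Furthermore, there are a translate $\mathcal{S}'=\mathcal{S}+t$ ($t\in\mathbb{K}_A$) of $\mathcal{S}$ and a $k\ge 1$ such that $\mathcal{F}+\mathcal{S}'$ is an atomic self-replicating tiling of $\mathbb{K}_A$ with associated expanding linear map $T=A^k$. (ii)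 If $\Delta$ is a group, then $\mathcal{F}+\Delta$ is a tiling of $\mathbb{K}_A$. -/

import Mathlib

open Set Filter Topology MeasureTheory
open scoped Pointwise

noncomputable section

namespace RationalTile

variable {n : ℕ}

/-- A rational matrix is expanding if all its complex eigenvalues lie outside the closed
unit disc. -/
def IsExpanding (A : Matrix (Fin n) (Fin n) ℚ) : Prop :=
  ∀ z ∈ spectrum ℂ (A.map (algebraMap ℚ ℂ)), 1 < ‖z‖

/-- Multiplication by a rational matrix, as an endomorphism of the additive group `ℚⁿ`. -/
def mulHom (M : Matrix (Fin n) (Fin n) ℚ) : (Fin n → ℚ) →+ (Fin n → ℚ) :=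
  M.mulVecLin.toAddMonoidHom

/-- The subgroup `ℤⁿ` of `ℚⁿ`. -/
def intLattice (n : ℕ) : AddSubgroup (Fin n → ℚ) :=
  AddSubgroup.pi Set.univ fun _ => (Int.castAddHom ℚ).range

/-- `ℤⁿ[A] = ℤⁿ + A ℤⁿ + A² ℤⁿ + ⋯`. -/
def polyLattice (A : Matrix (Fin n) (Fin n) ℚ) : AddSubgroup (Fin n → ℚ) :=
  ⨆ k : ℕ, (intLattice n).map (mulHom (A ^ k))

/-- `ℤⁿ(A) = ∑_{k ∈ ℤ} A ^ k ℤⁿ`. -/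
def laurentLattice (A : Matrix (Fin n) (Fin n) ℚ) : AddSubgroup (Fin n → ℚ) :=
  ⨆ k : ℤ, (intLattice n).map (mulHom (A ^ k))

/-- `a = |ℤⁿ[A] / A ℤⁿ[A]|`. -/
def aIndex (A : Matrix (Fin n) (Fin n) ℚ) : ℕ :=
  ((polyLattice A).map (mulHom A)).relIndex (polyLattice A)

/-- `b = |ℤⁿ[A⁻¹] / A⁻¹ ℤⁿ[A⁻¹]|`. -/
def bIndex (A : Matrix (Fin n) (Fin n) ℚ) : ℕ := aIndex A⁻¹

/-- The subgroup `B ^ k ℤⁿ[B]`, `k ∈ ℤ`, where `B = A⁻¹`. -/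
def bFil (A : Matrix (Fin n) (Fin n) ℚ) (k : ℤ) : AddSubgroup (Fin n → ℚ) :=
  (polyLattice A⁻¹).map (mulHom (A⁻¹ ^ k))

/-- The group `ℤⁿ(B) = ℤⁿ(A)` as a type of its own, which is to carry the `B`-adic metric. -/
def ZLaurent (A : Matrix (Fin n) (Fin n) ℚ) : Type := laurentLattice A

instance (A : Matrix (Fin n) (Fin n) ℚ) : AddCommGroup (ZLaurent A) :=
  inferInstanceAs (AddCommGroup (laurentLattice A))

/-- The inclusion `ℤⁿ(B) → ℚⁿ`. -/
def ZLaurent.val {A : Matrix (Fin n) (Fin n) ℚ} : ZLaurent A →+ (Fin n → ℚ) :=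
  (laurentLattice A).subtype

open Classical in
/-- The `B`-adic valuation: the `k` with `y ∈ B ^ k ℤⁿ[B] \ B ^ (k + 1) ℤⁿ[B]`, and `∞` if there
is none (as for `y = 0`). -/
def bVal {A : Matrix (Fin n) (Fin n) ℚ} (y : ZLaurent A) : WithTop ℤ :=
  if h : ∃ k : ℤ, y.val ∈ bFil A k ∧ y.val ∉ bFil A (k + 1) then (h.choose : ℤ) else ⊤

/-- `b ^ (-ν(y))`, the `B`-adic distance of `y` from `0`, with `b ^ (-∞) = 0`. -/
def bNorm {A : Matrix (Fin n) (Fin n) ℚ} (y : ZLaurent A) : ℝ :=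
  WithTop.recTopCoe (C := fun _ => ℝ) 0 (fun k : ℤ => (bIndex A : ℝ) ^ (-k)) (bVal y)

/-! ### Elementary facts on the filtration -/

section Basics

theorem mulHom_apply (M : Matrix (Fin n) (Fin n) ℚ) (x : Fin n → ℚ) :
    mulHom M x = M.mulVec x := rfl

theorem mulHom_mul (M N : Matrix (Fin n) (Fin n) ℚ) :
    mulHom (M * N) = (mulHom M).comp (mulHom N) := by
  refine AddMonoidHom.ext fun x => ?_
  simp [mulHom_apply, Matrix.mulVec_mulVec]

theorem mulHom_one : mulHom (1 : Matrix (Fin n) (Fin n) ℚ) = AddMonoidHom.id _ := by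
  refine AddMonoidHom.ext fun x => ?_
  simp [mulHom_apply]

theorem mem_intLattice {x : Fin n → ℚ} : x ∈ intLattice n ↔ ∀ i, ∃ m : ℤ, (m : ℚ) = x i := by
  simp [intLattice, AddSubgroup.mem_pi, AddSubgroup.mem_zmultiples_iff]

theorem IsExpanding.isUnit_det {A : Matrix (Fin n) (Fin n) ℚ} (h : IsExpanding A) :
    IsUnit A.det := by
  by_contra hA
  have h0 : (0 : ℂ) ∈ spectrum ℂ (A.map (algebraMap ℚ ℂ)) := by
    rw [spectrum.zero_mem_iff, Matrix.isUnit_iff_isUnit_det]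
    have : (A.map (algebraMap ℚ ℂ)).det = algebraMap ℚ ℂ A.det :=
      (RingHom.map_det (algebraMap ℚ ℂ) A).symm
    rw [this]
    simpa using hA
  have := h 0 h0
  simp at this
  linarith

theorem intLattice_le_polyLattice (A : Matrix (Fin n) (Fin n) ℚ) :
    intLattice n ≤ polyLattice A := by
  refine le_trans ?_ (le_iSup _ 0)
  simp [mulHom_one]

theorem map_polyLattice_le (A : Matrix (Fin n) (Fin n) ℚ) :
    (polyLattice A).map (mulHom A) ≤ polyLattice A := by
  rw [polyLattice, AddSubgroup.map_iSup]
  refine iSup_le fun k => le_trans (le_of_eq ?_) (le_iSup _ (k + 1))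
  rw [AddSubgroup.map_map, ← mulHom_mul, pow_succ']

theorem bFil_succ {A : Matrix (Fin n) (Fin n) ℚ} (hA : IsUnit A.det) (k : ℤ) :
    bFil A (k + 1) = ((polyLattice A⁻¹).map (mulHom A⁻¹)).map (mulHom (A⁻¹ ^ k)) := by
  rw [bFil, Matrix.zpow_add_one (Matrix.isUnit_nonsing_inv_det A hA), mulHom_mul,
    AddSubgroup.map_map]

theorem bFil_antitone {A : Matrix (Fin n) (Fin n) ℚ} (hA : IsUnit A.det) :
    Antitone (bFil A) :=
  antitone_int_of_succ_le fun k => by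
    rw [bFil_succ hA]
    exact AddSubgroup.map_mono (map_polyLattice_le _)

theorem bFil_zero (A : Matrix (Fin n) (Fin n) ℚ) : bFil A 0 = polyLattice A⁻¹ := by
  simp [bFil, mulHom_one]

theorem polyLattice_inv_le (A : Matrix (Fin n) (Fin n) ℚ) (hA : IsUnit A.det) :
    polyLattice A⁻¹ ≤ laurentLattice A :=
  iSup_le fun k => le_trans (le_of_eq (by
    rw [Matrix.zpow_neg hA, zpow_natCast, Matrix.inv_pow'])) (le_iSup _ (-(k : ℤ)))

theorem polyLattice_le (A : Matrix (Fin n) (Fin n) ℚ) :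
    polyLattice A ≤ laurentLattice A :=
  iSup_le fun k => le_trans (le_of_eq (by rw [zpow_natCast])) (le_iSup _ (k : ℤ))

theorem mem_bFil_zpow {A : Matrix (Fin n) (Fin n) ℚ} (hA : IsUnit A.det) (j k : ℤ)
    {y : Fin n → ℚ} (hy : y ∈ bFil A j) : mulHom (A ^ k) y ∈ bFil A (j - k) := by
  obtain ⟨p, hp, rfl⟩ := hy
  refine ⟨p, hp, ?_⟩
  have : A⁻¹ ^ (j - k) = A ^ k * A⁻¹ ^ j := by
    rw [Matrix.inv_zpow' hA, Matrix.inv_zpow' hA, ← Matrix.zpow_add hA]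
    congr 1
    ring
  rw [this, mulHom_mul]
  rfl

theorem zpow_mem_laurentLattice {A : Matrix (Fin n) (Fin n) ℚ} (hA : IsUnit A.det) (k : ℤ)
    {y : Fin n → ℚ} (hy : y ∈ laurentLattice A) : mulHom (A ^ k) y ∈ laurentLattice A := by
  have h : (laurentLattice A).map (mulHom (A ^ k)) ≤ laurentLattice A := by
    rw [laurentLattice, AddSubgroup.map_iSup]
    refine iSup_le fun j => le_trans (le_of_eq ?_) (le_iSup _ (k + j))
    rw [AddSubgroup.map_map, ← mulHom_mul, Matrix.zpow_add hA]
  exact h ⟨y, hy, rfl⟩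

theorem exists_mem_bFil {A : Matrix (Fin n) (Fin n) ℚ} (hA : IsUnit A.det) (y : ZLaurent A) :
    ∃ k, y.val ∈ bFil A k := by
  obtain ⟨y, hy⟩ := y
  change ∃ k, y ∈ bFil A k
  refine AddSubgroup.iSup_induction (C := fun y => ∃ k, y ∈ bFil A k) _ hy ?_ ?_ ?_
  · rintro k _ ⟨z, hz, rfl⟩
    refine ⟨-k, z, intLattice_le_polyLattice _ hz, ?_⟩
    rw [Matrix.inv_zpow' hA, neg_neg]
  · exact ⟨0, zero_mem _⟩
  · rintro x y ⟨j, hj⟩ ⟨k, hk⟩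
    exact ⟨min j k, add_mem (bFil_antitone hA (min_le_left _ _) hj)
      (bFil_antitone hA (min_le_right _ _) hk)⟩

theorem bNorm_eq {A : Matrix (Fin n) (Fin n) ℚ} (hA : IsUnit A.det) {y : ZLaurent A} {k : ℤ}
    (h1 : y.val ∈ bFil A k) (h2 : y.val ∉ bFil A (k + 1)) :
    bNorm y = (bIndex A : ℝ) ^ (-k) := by
  have h : ∃ k : ℤ, y.val ∈ bFil A k ∧ y.val ∉ bFil A (k + 1) := ⟨k, h1, h2⟩
  have hk : h.choose = k := by
    obtain ⟨h3, h4⟩ := h.choose_spec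
    refine le_antisymm ?_ ?_
    · by_contra hlt
      exact h2 (bFil_antitone hA (by omega) h3)
    · by_contra hlt
      exact h4 (bFil_antitone hA (by omega) h1)
  rw [bNorm, bVal, dif_pos h, hk]
  rfl

theorem bNorm_eq_zero {A : Matrix (Fin n) (Fin n) ℚ} {y : ZLaurent A}
    (h : ∀ k, y.val ∈ bFil A k) : bNorm y = 0 := by
  rw [bNorm, bVal, dif_neg]
  · rfl
  · rintro ⟨k, -, h2⟩
    exact h2 (h _)

theorem mem_all_or {A : Matrix (Fin n) (Fin n) ℚ} (hA : IsUnit A.det) (y : ZLaurent A) :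
    (∀ k, y.val ∈ bFil A k) ∨ ∃ k, y.val ∈ bFil A k ∧ y.val ∉ bFil A (k + 1) := by
  by_contra! hcon
  obtain ⟨⟨k, hk⟩, h2⟩ := hcon
  obtain ⟨j, hj⟩ := exists_mem_bFil hA y
  refine hk ?_
  have : ∀ m : ℕ, y.val ∈ bFil A (j + m) := by
    intro m
    induction m with
    | zero => simpa using hj
    | succ m ih => simpa [add_assoc] using h2 _ ih
  exact bFil_antitone hA (show k ≤ j + ((k - j).toNat : ℤ) by omega) (this _)

theorem bNorm_nonneg {A : Matrix (Fin n) (Fin n) ℚ} (hA : IsUnit A.det) (y : ZLaurent A) :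
    0 ≤ bNorm y := by
  rcases mem_all_or hA y with h | ⟨k, h1, h2⟩
  · rw [bNorm_eq_zero h]
  · rw [bNorm_eq hA h1 h2]
    positivity

theorem bNorm_le_iff {A : Matrix (Fin n) (Fin n) ℚ} (hA : IsUnit A.det) (hb : 2 ≤ bIndex A)
    {y : ZLaurent A} {j : ℤ} : bNorm y ≤ (bIndex A : ℝ) ^ (-j) ↔ y.val ∈ bFil A j := by
  have hb' : (1 : ℝ) < bIndex A := by exact_mod_cast hb
  rcases mem_all_or hA y with h | ⟨k, h1, h2⟩
  · rw [bNorm_eq_zero h]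
    exact iff_of_true (by positivity) (h j)
  · rw [bNorm_eq hA h1 h2, zpow_le_zpow_iff_right₀ hb']
    constructor
    · intro hjk
      exact bFil_antitone hA (by omega) h1
    · intro hj
      by_contra hlt
      exact h2 (bFil_antitone hA (by omega) hj)

theorem bNorm_add_le_max {A : Matrix (Fin n) (Fin n) ℚ} (hA : IsUnit A.det) (hb : 2 ≤ bIndex A)
    (x y : ZLaurent A) : bNorm (x + y) ≤ max (bNorm x) (bNorm y) := by
  wlog hxy : bNorm x ≤ bNorm y generalizing x y
  · rw [add_comm, max_comm]
    exact this y x (le_of_not_ge hxy)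
  rw [max_eq_right hxy]
  rcases mem_all_or hA y with h | ⟨k, h1, h2⟩
  · have hx : ∀ k, x.val ∈ bFil A k := fun k => by
      rw [← bNorm_le_iff hA hb]
      rw [bNorm_eq_zero h] at hxy
      exact hxy.trans (by positivity)
    rw [bNorm_eq_zero h, bNorm_eq_zero]
    intro k
    rw [map_add]
    exact add_mem (hx k) (h k)
  · rw [bNorm_eq hA h1 h2] at hxy ⊢
    rw [bNorm_le_iff hA hb] at hxy ⊢
    rw [map_add]
    exact add_mem hxy h1

theorem bNorm_neg {A : Matrix (Fin n) (Fin n) ℚ} (hA : IsUnit A.det) (y : ZLaurent A) :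
    bNorm (-y) = bNorm y := by
  have hneg : ∀ k, (-y).val ∈ bFil A k ↔ y.val ∈ bFil A k := fun k => by
    rw [map_neg, neg_mem_iff]
  rcases mem_all_or hA y with h | ⟨k, h1, h2⟩
  · rw [bNorm_eq_zero h, bNorm_eq_zero fun k => (hneg k).2 (h k)]
  · rw [bNorm_eq hA h1 h2, bNorm_eq hA ((hneg _).2 h1) (mt (hneg _).1 h2)]

theorem bNorm_zero (A : Matrix (Fin n) (Fin n) ℚ) : bNorm (0 : ZLaurent A) = 0 :=
  bNorm_eq_zero fun k => by simp

end Basics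

/-- Multiplication by `A ^ k` on `ℤⁿ(B)`. -/
def powZ (A : Matrix (Fin n) (Fin n) ℚ) [hA : Fact (IsExpanding A)] (k : ℤ) :
    ZLaurent A →+ ZLaurent A :=
  ((mulHom (A ^ k)).comp ZLaurent.val).codRestrict (laurentLattice A)
    fun x => zpow_mem_laurentLattice hA.out.isUnit_det k x.2

theorem val_powZ (A : Matrix (Fin n) (Fin n) ℚ) [hA : Fact (IsExpanding A)] (k : ℤ)
    (x : ZLaurent A) : (powZ A k x).val = mulHom (A ^ k) x.val := rfl

/-! ### The representation space -/

section Space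

variable (A : Matrix (Fin n) (Fin n) ℚ) [hA : Fact (IsExpanding A)] [hb : Fact (2 ≤ bIndex A)]

/-- The `B`-adic (pseudo-)metric `d(y, y') = b ^ (-ν(y - y'))` on `ℤⁿ(B)`. -/
instance : SeminormedAddCommGroup (ZLaurent A) :=
  AddGroupSeminorm.toSeminormedAddCommGroup
    { toFun := bNorm
      map_zero' := bNorm_zero A
      add_le' := fun x y => (bNorm_add_le_max hA.out.isUnit_det hb.out x y).trans
        (max_le_add_of_nonneg (bNorm_nonneg hA.out.isUnit_det x)
          (bNorm_nonneg hA.out.isUnit_det y))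
      neg' := bNorm_neg hA.out.isUnit_det }

theorem norm_def (y : ZLaurent A) : ‖y‖ = bNorm y := rfl

/-- The `B`-adic series `ℤⁿ((B))`: the (Hausdorff) completion of `ℤⁿ(B)`. -/
abbrev BSeries : Type := UniformSpace.Completion (ZLaurent A)

/-- The representation space `𝕂_A = ℝⁿ × ℤⁿ((B))`, with the maximum metric. -/
abbrev KSpace : Type := EuclideanSpace ℝ (Fin n) × BSeries A

/-- The diagonal embedding `φ : ℤⁿ(B) → 𝕂_A`, `x ↦ (x, x)`. -/
def phi (x : ZLaurent A) : KSpace A :=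
  (WithLp.toLp 2 fun i => ((x.val i : ℚ) : ℝ), (x : BSeries A))

/-- The image `φ(M)` of a set `M` of vectors of `ℤⁿ(B)`. -/
def phiImage (M : Set (Fin n → ℚ)) : Set (KSpace A) :=
  phi A '' {x | x.val ∈ M}

theorem norm_powZ (k : ℤ) (x : ZLaurent A) : ‖powZ A k x‖ = (bIndex A : ℝ) ^ k * ‖x‖ := by
  have hb0 : (bIndex A : ℝ) ≠ 0 := by
    have := hb.out
    positivity
  have hd := hA.out.isUnit_det
  have hiff : ∀ j, (powZ A k x).val ∈ bFil A (j - k) ↔ x.val ∈ bFil A j := fun j => by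
    constructor
    · intro h
      have := mem_bFil_zpow hd _ (-k) h
      rw [val_powZ, ← AddMonoidHom.comp_apply, ← mulHom_mul, Matrix.zpow_neg_mul_zpow_self _ hd,
        mulHom_one] at this
      simpa using this
    · exact mem_bFil_zpow hd j k
  rw [norm_def, norm_def]
  rcases mem_all_or hd x with h | ⟨j, h1, h2⟩
  · rw [bNorm_eq_zero h, bNorm_eq_zero, mul_zero]
    intro j
    have := (hiff (j + k)).2 (h _)
    simpa using this
  · rw [bNorm_eq hd h1 h2, bNorm_eq hd ((hiff j).2 h1), ← zpow_add₀ hb0]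
    · congr 1
      ring
    · rw [sub_add_eq_add_sub]
      exact mt (hiff _).1 h2

theorem continuous_powZ (k : ℤ) : Continuous (powZ A k) :=
  AddMonoidHomClass.continuous_of_bound (powZ A k) _ fun x => (norm_powZ A k x).le

/-- Multiplication by `A ^ k` on `ℤⁿ((B))`, extended by continuity from `ℤⁿ(B)`. -/
def powB (k : ℤ) : BSeries A →+ BSeries A := (powZ A k).completion (continuous_powZ A k)

theorem continuous_powB (k : ℤ) : Continuous (powB A k) :=
  AddMonoidHom.continuous_completion (powZ A k) (continuous_powZ A k)

theorem powB_coe (k : ℤ) (y : ZLaurent A) : powB A k (y : BSeries A) = (powZ A k y : ZLaurent A) :=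
  AddMonoidHom.completion_coe (powZ A k) (continuous_powZ A k) y

/-- The action of the matrix `A ^ k` on `𝕂_A`: `(x, y) ↦ (A ^ k x, A ^ k y)`. -/
def act (k : ℤ) : KSpace A →+ KSpace A :=
  ((Matrix.toEuclideanLin ((A ^ k).map (algebraMap ℚ ℝ))).toAddMonoidHom).prodMap (powB A k)

/-! ### The Haar measure -/

theorem relIndex_bFil_ne_zero (k : ℕ) : (bFil A k).relIndex (bFil A 0) ≠ 0 := by
  induction k with
  | zero => simp
  | succ k ih =>
    refine AddSubgroup.relIndex_ne_zero_trans (K := bFil A k) ?_ ih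
    have hd := hA.out.isUnit_det
    have hinj : Function.Injective (mulHom (A⁻¹ ^ (k : ℤ))) := by
      have hu := Matrix.isUnit_nonsing_inv_det A hd
      refine Function.LeftInverse.injective (g := mulHom (A⁻¹ ^ (-(k : ℤ)))) fun x => ?_
      rw [← AddMonoidHom.comp_apply, ← mulHom_mul, Matrix.zpow_neg_mul_zpow_self _ hu, mulHom_one]
      rfl
    rw [Nat.cast_succ, bFil_succ hd, bFil, AddSubgroup.relIndex_map_map_of_injective _ _ hinj]
    have := hb.out
    change bIndex A ≠ 0
    omega

theorem norm_le_one_iff {x : ZLaurent A} : ‖x‖ ≤ 1 ↔ x.val ∈ bFil A 0 := by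
  rw [← bNorm_le_iff hA.out.isUnit_det hb.out]
  simp [norm_def]

theorem norm_le_one_of_lt_two {x : ZLaurent A} (h : ‖x‖ < 2) : ‖x‖ ≤ 1 := by
  have hb' : (2 : ℝ) ≤ bIndex A := by exact_mod_cast hb.out
  rw [norm_def] at h ⊢
  rcases mem_all_or hA.out.isUnit_det x with h0 | ⟨k, h1, h2⟩
  · rw [bNorm_eq_zero h0]
    exact zero_le_one
  · rw [bNorm_eq hA.out.isUnit_det h1 h2] at h ⊢
    have : -k < 1 := by
      rw [← zpow_lt_zpow_iff_right₀ (show (1 : ℝ) < bIndex A by linarith)]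
      simpa using h.trans_le hb'
    exact zpow_le_one_of_nonpos₀ (by linarith) (by omega)

theorem totallyBounded_unitBall : TotallyBounded (Metric.closedBall (0 : ZLaurent A) 1) := by
  have hb' : (2 : ℝ) ≤ bIndex A := by exact_mod_cast hb.out
  have hd := hA.out.isUnit_det
  rw [Metric.totallyBounded_iff]
  intro ε hε
  obtain ⟨k, hk⟩ := exists_pow_lt_of_lt_one hε
    (show ((bIndex A : ℝ))⁻¹ < 1 from inv_lt_one_of_one_lt₀ (by linarith))
  have hfin : Finite (bFil A 0 ⧸ (bFil A k).addSubgroupOf (bFil A 0)) :=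
    Nat.finite_of_card_ne_zero (relIndex_bFil_ne_zero A k)
  have hle : ∀ q : bFil A 0, (q : Fin n → ℚ) ∈ laurentLattice A := fun q => by
    apply polyLattice_inv_le A hd
    rw [← bFil_zero]
    exact q.2
  let g : (bFil A 0 ⧸ (bFil A k).addSubgroupOf (bFil A 0)) → ZLaurent A :=
    fun q => ⟨(q.out : bFil A 0), hle _⟩
  refine ⟨Set.range g, Set.finite_range _, ?_⟩
  intro x hx
  rw [mem_closedBall_zero_iff, norm_le_one_iff] at hx
  let x' : bFil A 0 := ⟨x.val, hx⟩
  have hq : -(Quotient.out (x' : bFil A 0 ⧸ (bFil A k).addSubgroupOf (bFil A 0))) + x' ∈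
      (bFil A k).addSubgroupOf (bFil A 0) :=
    QuotientAddGroup.eq.1 (QuotientAddGroup.out_eq' _)
  refine Set.mem_biUnion ⟨(x' : bFil A 0 ⧸ (bFil A k).addSubgroupOf (bFil A 0)), rfl⟩ ?_
  rw [Metric.mem_ball, dist_eq_norm]
  refine lt_of_le_of_lt (b := bNorm (x - g x')) le_rfl (lt_of_le_of_lt ?_ hk)
  rw [inv_pow, ← zpow_natCast, ← zpow_neg, bNorm_le_iff hd hb.out]
  rw [AddSubgroup.mem_addSubgroupOf] at hq
  rw [neg_add_eq_sub] at hq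
  exact hq

theorem isCompact_unitBall : IsCompact (Metric.closedBall (0 : BSeries A) 1) := by
  have h1 : TotallyBounded (closure ((fun x : ZLaurent A => (x : BSeries A)) ''
      Metric.closedBall 0 1)) :=
    ((totallyBounded_unitBall A).image
      (UniformSpace.Completion.uniformContinuous_coe _)).closure
  refine (h1.subset ?_).isCompact_of_isClosed Metric.isClosed_closedBall
  intro y hy
  rw [Metric.mem_closure_iff]
  intro ε hε
  obtain ⟨x, hx⟩ := (UniformSpace.Completion.denseRange_coe (α := ZLaurent A)).exists_dist_lt y
    (lt_min hε one_pos)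
  refine ⟨x, ⟨x, ?_, rfl⟩, hx.trans_le (min_le_left _ _)⟩
  rw [mem_closedBall_zero_iff] at hy ⊢
  apply norm_le_one_of_lt_two
  have h2 : ‖(x : BSeries A) - y‖ < 1 := by
    rw [← dist_eq_norm, dist_comm]
    exact hx.trans_le (min_le_right _ _)
  rw [← UniformSpace.Completion.norm_coe x]
  calc ‖(x : BSeries A)‖ = ‖((x : BSeries A) - y) + y‖ := by rw [sub_add_cancel]
    _ ≤ ‖(x : BSeries A) - y‖ + ‖y‖ := norm_add_le _ _
    _ < 2 := by linarith

instance : MeasurableSpace (BSeries A) := borel _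

instance : BorelSpace (BSeries A) := ⟨rfl⟩

/-- `ℤⁿ[[B]]`, the set of points of `ℤⁿ((B))` of nonnegative valuation, that is, the closed unit
ball. -/
def integerBall : TopologicalSpace.PositiveCompacts (BSeries A) where
  carrier := Metric.closedBall 0 1
  isCompact' := isCompact_unitBall A
  interior_nonempty' := ⟨0, Metric.ball_subset_interior_closedBall (Metric.mem_ball_self one_pos)⟩

/-- The `B`-adic measure: the Haar measure on `ℤⁿ((B))` with `μ_B(ℤⁿ[[B]]) = 1`. -/
def muB : Measure (BSeries A) := Measure.addHaarMeasure (integerBall A)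

/-- The Haar measure `μ = λ × μ_B` on `𝕂_A`. -/
def mu : Measure (KSpace A) := (volume : Measure (EuclideanSpace ℝ (Fin n))).prod (muB A)

/-! ### The self-affine set `F(A, D)` -/

theorem act_add (j k : ℤ) (p : KSpace A) : act A (j + k) p = act A j (act A k p) := by
  have hd := hA.out.isUnit_det
  obtain ⟨x, y⟩ := p
  refine Prod.ext ?_ ?_
  · change Matrix.toEuclideanLin _ x = Matrix.toEuclideanLin _ (Matrix.toEuclideanLin _ x)
    have : (A ^ (j + k)).map (algebraMap ℚ ℝ) =
        (A ^ j).map (algebraMap ℚ ℝ) * (A ^ k).map (algebraMap ℚ ℝ) := by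
      rw [Matrix.zpow_add hd, Matrix.map_mul]
    rw [this]
    simp [Matrix.toEuclideanLin, Matrix.toLpLin_apply, Matrix.mulVec_mulVec]
  · change powB A (j + k) y = powB A j (powB A k y)
    induction y using UniformSpace.Completion.induction_on with
    | hp =>
      exact isClosed_eq (continuous_powB A _)
        ((continuous_powB A _).comp (continuous_powB A _))
    | ih y =>
      rw [powB_coe, powB_coe, powB_coe]
      congr 1
      apply Subtype.ext
      change mulHom (A ^ (j + k)) y.val = mulHom (A ^ j) (mulHom (A ^ k) y.val)
      rw [Matrix.zpow_add hd, mulHom_mul]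
      rfl

theorem act_zero (p : KSpace A) : act A 0 p = p := by
  obtain ⟨x, y⟩ := p
  refine Prod.ext ?_ ?_
  · change Matrix.toEuclideanLin _ x = x
    simp
  · change powB A 0 y = y
    induction y using UniformSpace.Completion.induction_on with
    | hp => exact isClosed_eq (continuous_powB A _) continuous_id
    | ih y =>
      rw [powB_coe]
      congr 1
      apply Subtype.ext
      change mulHom (A ^ (0 : ℤ)) y.val = y.val
      rw [zpow_zero, mulHom_one]
      rfl

theorem continuous_act (k : ℤ) : Continuous (act A k) :=
  Continuous.prodMk
    ((LinearMap.continuous_of_finiteDimensional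
      (Matrix.toEuclideanLin ((A ^ k).map (algebraMap ℚ ℝ)))).comp continuous_fst)
    ((continuous_powB A k).comp continuous_snd)

theorem norm_powB (k : ℤ) (y : BSeries A) :
    ‖powB A k y‖ = (bIndex A : ℝ) ^ k * ‖y‖ := by
  induction y using UniformSpace.Completion.induction_on with
  | hp =>
    exact isClosed_eq (continuous_powB A k).norm
      (continuous_const.mul continuous_norm)
  | ih y => rw [powB_coe, UniformSpace.Completion.norm_coe, norm_powZ,
      UniformSpace.Completion.norm_coe]

theorem norm_real_le (M : Matrix (Fin n) (Fin n) ℚ) (x : EuclideanSpace ℝ (Fin n)) :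
    ‖Matrix.toEuclideanLin (M.map (algebraMap ℚ ℝ)) x‖ ≤
      ‖Matrix.toEuclideanCLM (n := Fin n) (𝕜 := ℂ) (M.map (algebraMap ℚ ℂ))‖ * ‖x‖ := by
  let c : EuclideanSpace ℝ (Fin n) → EuclideanSpace ℂ (Fin n) :=
    fun x => WithLp.toLp 2 fun i => (x i : ℂ)
  have hc : ∀ x, ‖c x‖ = ‖x‖ := fun x => by
    simp [c, EuclideanSpace.norm_eq]
  have hM : c (Matrix.toEuclideanLin (M.map (algebraMap ℚ ℝ)) x) =
      Matrix.toEuclideanCLM (n := Fin n) (𝕜 := ℂ) (M.map (algebraMap ℚ ℂ)) (c x) := by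
    ext i
    simp [c, Matrix.mulVec, dotProduct]
  rw [← hc, hM, ← hc x]
  exact ContinuousLinearMap.le_opNorm _ _

theorem exists_real_bound (A : Matrix (Fin n) (Fin n) ℚ) (hA : IsExpanding A) :
    ∃ C r : ℝ, 0 ≤ r ∧ r < 1 ∧ ∀ (k : ℕ) (x : EuclideanSpace ℝ (Fin n)),
      ‖Matrix.toEuclideanLin ((A ^ (-(k : ℤ))).map (algebraMap ℚ ℝ)) x‖ ≤ C * r ^ k * ‖x‖ := by
  rcases Nat.eq_zero_or_pos n with rfl | hn
  · refine ⟨0, 0, le_rfl, one_pos, fun k x => ?_⟩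
    rw [Subsingleton.elim x 0]
    simp
  have : Nonempty (Fin n) := ⟨⟨0, hn⟩⟩
  have hd := hA.isUnit_det
  let Ac : Matrix (Fin n) (Fin n) ℂ := A.map (algebraMap ℚ ℂ)
  let Bc : Matrix (Fin n) (Fin n) ℂ := A⁻¹.map (algebraMap ℚ ℂ)
  have hAB : Ac * Bc = 1 := by
    rw [← Matrix.map_mul, Matrix.mul_nonsing_inv _ hd]
    simp
  have hBA : Bc * Ac = 1 := by
    rw [← Matrix.map_mul, Matrix.nonsing_inv_mul _ hd]
    simp
  let T : EuclideanSpace ℂ (Fin n) →L[ℂ] EuclideanSpace ℂ (Fin n) :=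
    Matrix.toEuclideanCLM (n := Fin n) (𝕜 := ℂ) Bc
  have hspec : ∀ z ∈ spectrum ℂ T, ‖z‖₊ < 1 := by
    intro z hz
    rw [AlgEquiv.spectrum_eq (Matrix.toEuclideanCLM (n := Fin n) (𝕜 := ℂ))] at hz
    have hu : IsUnit Bc := ⟨⟨Bc, Ac, hBA, hAB⟩, rfl⟩
    have hz0 : z ≠ 0 := spectrum.ne_zero_of_mem_of_unit (a := hu.unit) hz
    have h2 : z⁻¹ ∈ spectrum ℂ Ac := by
      let u : (Matrix (Fin n) (Fin n) ℂ)ˣ := ⟨Bc, Ac, hBA, hAB⟩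
      exact spectrum.inv₀_mem_inv_iff (a := u) |>.2 hz
    have h3 := hA _ h2
    rw [norm_inv] at h3
    have h4 : ‖z‖ < 1 := (one_lt_inv₀ (norm_pos_iff.2 hz0)).1 h3
    exact_mod_cast h4
  have hrad : spectralRadius ℂ T < (1 : NNReal) :=
    spectrum.spectralRadius_lt_of_forall_lt T hspec
  obtain ⟨r, hr1, hr2⟩ := ENNReal.lt_iff_exists_nnreal_btwn.1 hrad
  have hev := (spectrum.pow_nnnorm_pow_one_div_tendsto_nhds_spectralRadius T).eventually_lt_const hr1
  have hr0 : 0 < r := by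
    rw [← ENNReal.coe_pos]
    exact lt_of_le_of_lt zero_le hr1
  have hr2' : r < 1 := by exact_mod_cast hr2
  obtain ⟨N, hN⟩ := eventually_atTop.1 (hev.and (eventually_gt_atTop 0))
  have hpow : ∀ k ≥ N, ‖T ^ k‖₊ ≤ r ^ k := by
    intro k hk
    obtain ⟨h1, h2⟩ := hN k hk
    have h3 : ((‖T ^ k‖₊ : ENNReal) ^ (1 / k : ℝ)) ^ (k : ℝ) ≤ (r : ENNReal) ^ (k : ℝ) :=
      ENNReal.rpow_le_rpow h1.le (by positivity)
    rw [← ENNReal.rpow_mul, one_div, inv_mul_cancel₀ (by positivity), ENNReal.rpow_one,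
      ENNReal.rpow_natCast] at h3
    exact_mod_cast h3
  let C : ℝ := 1 + ∑ k ∈ Finset.range N, ‖T ^ k‖ / (r : ℝ) ^ k
  have hsum : 0 ≤ ∑ k ∈ Finset.range N, ‖T ^ k‖ / (r : ℝ) ^ k :=
    Finset.sum_nonneg fun _ _ => by positivity
  refine ⟨C, r, r.2, hr2', fun k x => (norm_real_le _ _).trans ?_⟩
  have hT : Matrix.toEuclideanCLM (n := Fin n) (𝕜 := ℂ)
      ((A ^ (-(k : ℤ))).map (algebraMap ℚ ℂ)) = T ^ k := by
    rw [← map_pow, Matrix.zpow_neg hd, zpow_natCast, ← Matrix.inv_pow']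
    congr 1
    exact (Matrix.map_pow A⁻¹ (algebraMap ℚ ℂ) k)
  rw [hT]
  refine mul_le_mul_of_nonneg_right ?_ (norm_nonneg _)
  rcases lt_or_ge k N with hk | hk
  · have h1 : ‖T ^ k‖ / (r : ℝ) ^ k ≤ C := by
      refine le_trans (Finset.single_le_sum (f := fun k => ‖T ^ k‖ / (r : ℝ) ^ k)
        (fun _ _ => by positivity) (Finset.mem_range.2 hk)) ?_
      simp [C]
    rwa [div_le_iff₀ (by positivity)] at h1
  · have h1 : ‖T ^ k‖ ≤ (r : ℝ) ^ k := by exact_mod_cast hpow k hk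
    refine h1.trans (le_mul_of_one_le_left (by positivity) ?_)
    simp only [C]
    linarith

/-- `A⁻¹` is eventually a contraction of `𝕂_A`, at an exponential rate. -/
theorem exists_bound : ∃ C r : ℝ, 0 ≤ C ∧ 0 ≤ r ∧ r < 1 ∧ ∀ (k : ℕ) (p : KSpace A),
    ‖act A (-(k : ℤ)) p‖ ≤ C * r ^ k * ‖p‖ := by
  obtain ⟨C, r, hr0, hr1, h⟩ := exists_real_bound A hA.out
  have hb' : (2 : ℝ) ≤ bIndex A := by exact_mod_cast hb.out
  refine ⟨max C 1, max r (1 / 2), by positivity, le_max_of_le_left hr0, max_lt hr1 (by norm_num), fun k p => ?_⟩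
  obtain ⟨x, y⟩ := p
  rw [Prod.norm_def]
  refine max_le ?_ ?_
  · refine (h k x).trans ?_
    gcongr
    · exact le_max_left _ _
    · exact le_max_left _ _
    · exact le_max_left ‖x‖ ‖y‖
  · change ‖powB A (-(k : ℤ)) y‖ ≤ _
    rw [norm_powB, zpow_neg, zpow_natCast, ← inv_pow]
    have h1 : ((bIndex A : ℝ))⁻¹ ≤ max r (1 / 2) := by
      refine le_trans ?_ (le_max_right _ _)
      rw [one_div]
      exact inv_anti₀ (by norm_num) hb'
    calc ((bIndex A : ℝ))⁻¹ ^ k * ‖y‖ ≤ 1 * (max r (1 / 2)) ^ k * ‖y‖ := by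
          rw [one_mul]
          gcongr
      _ ≤ _ := by
          gcongr
          · exact le_max_right _ _
          · exact le_max_right ‖x‖ ‖y‖

/-- The translate `F + s`. -/
def translate {A : Matrix (Fin n) (Fin n) ℚ} [Fact (IsExpanding A)] [Fact (2 ≤ bIndex A)]
    (F : Set (KSpace A)) (s : KSpace A) : Set (KSpace A) := (fun p => p + s) '' F

theorem existsUnique_of_finite (E : Set (KSpace A)) (hE : E.Finite) (hE' : E.Nonempty) :
    ∃! F : Set (KSpace A), F.Nonempty ∧ IsCompact F ∧
      act A 1 '' F = ⋃ p ∈ E, translate F p := by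
  obtain ⟨C, r, hC0, hr0, hr1, hC⟩ := exists_bound A
  have : CompactSpace E := isCompact_iff_compactSpace.1 hE.isCompact
  have : Nonempty E := hE'.to_subtype
  obtain ⟨R, hR⟩ := hE.isBounded.exists_norm_le
  have hgeo : Summable fun j : ℕ => C * r ^ (j + 1) * R :=
    (((summable_geometric_of_lt_one hr0 hr1).comp_injective
      (add_left_injective 1)).mul_left C).mul_right R
  let t : (ℕ → E) → ℕ → KSpace A := fun d j => act A (-((j + 1 : ℕ) : ℤ)) (d j)
  have hterm : ∀ j d, ‖t d j‖ ≤ C * r ^ (j + 1) * R := fun j d =>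
    (hC (j + 1) (d j)).trans (mul_le_mul_of_nonneg_left (hR _ (d j).2) (by positivity))
  have hsum : ∀ d, Summable (t d) := fun d => Summable.of_norm_bounded hgeo fun j => hterm j d
  let G : (ℕ → E) → KSpace A := fun d => ∑' j, t d j
  have hG : Continuous G := continuous_tsum (fun j => (continuous_act A _).comp
    (continuous_subtype_val.comp (continuous_apply j))) hgeo hterm
  have hinv : ∀ p, act A (-1) (act A 1 p) = p := fun p => by
    rw [← act_add, neg_add_cancel, act_zero]
  have hinv' : ∀ p, act A 1 (act A (-1) p) = p := fun p => by
    rw [← act_add, add_neg_cancel, act_zero]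
  have hshift : ∀ d, act A 1 (G d) = G (fun j => d (j + 1)) + d 0 := by
    intro d
    have h1 := ((hsum d).hasSum.map (act A 1) (continuous_act A 1)).tsum_eq
    change act A 1 (∑' j, t d j) = _
    rw [← h1, (((hsum d).hasSum.map (act A 1) (continuous_act A 1)).summable).tsum_eq_zero_add,
      add_comm]
    congr 1
    · refine tsum_congr fun j => ?_
      change act A 1 (act A _ _) = act A _ _
      rw [← act_add]
      congr 2
    · change act A 1 (act A _ _) = _
      exact hinv' _
  refine ⟨Set.range G, ⟨Set.range_nonempty _, isCompact_range hG, ?_⟩, ?_⟩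
  · ext p
    simp only [Set.mem_image, Set.mem_range, exists_exists_eq_and, Set.mem_iUnion, translate,
      exists_prop]
    constructor
    · rintro ⟨d, rfl⟩
      exact ⟨d 0, (d 0).2, fun j => d (j + 1), (hshift d).symm⟩
    · rintro ⟨e, he, d, rfl⟩
      let d' : ℕ → E := fun j => Nat.casesOn j ⟨e, he⟩ d
      have h0 : d' 0 = ⟨e, he⟩ := rfl
      have h1 : (fun j => d' (j + 1)) = d := rfl
      have h2 := hshift d'
      rw [h0, h1] at h2
      exact ⟨d', h2⟩
  · rintro X ⟨hX, hXc, hXe⟩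
    obtain ⟨S, hS⟩ := hXc.isBounded.exists_norm_le
    have hzero : ∀ x : ℕ → KSpace A, (∀ k, x k ∈ X) →
        Tendsto (fun k : ℕ => act A (-(k : ℤ)) (x k)) atTop (𝓝 0) := by
      intro x hx
      have h0 : Tendsto (fun k : ℕ => C * r ^ k * S) atTop (𝓝 0) := by
        simpa using ((tendsto_pow_atTop_nhds_zero_of_lt_one hr0 hr1).const_mul C).mul_const S
      exact squeeze_zero_norm (fun k => (hC k (x k)).trans
        (mul_le_mul_of_nonneg_left (hS _ (hx k)) (by positivity))) h0
    apply Set.Subset.antisymm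
    · have hstep : ∀ x : X, ∃ e : E, ∃ y : X, act A 1 (x : KSpace A) = y + e := by
        intro x
        have h1 : act A 1 (x : KSpace A) ∈ ⋃ p ∈ E, translate X p := hXe ▸ ⟨x, x.2, rfl⟩
        simp only [Set.mem_iUnion, translate, exists_prop] at h1
        obtain ⟨e, he, y, hy, hye⟩ := h1
        exact ⟨⟨e, he⟩, ⟨y, hy⟩, hye.symm⟩
      choose dig nxt hdn using hstep
      intro x hx
      let o : ℕ → X := fun k => nxt^[k] ⟨x, hx⟩
      refine ⟨fun k => dig (o k), ?_⟩
      have hpart : ∀ k : ℕ, x = ∑ j ∈ Finset.range k, t (fun k => dig (o k)) j +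
          act A (-(k : ℤ)) (o k) := by
        intro k
        induction k with
        | zero => simp [act_zero, o]
        | succ k ih =>
          rw [Finset.sum_range_succ]
          nth_rewrite 1 [ih]
          rw [add_assoc]
          congr 1
          change _ = act A (-((k + 1 : ℕ) : ℤ)) (dig (o k)) + act A (-((k + 1 : ℕ) : ℤ)) (o (k + 1))
          rw [← map_add, add_comm (dig (o k) : KSpace A)]
          have : (o (k + 1) : KSpace A) + dig (o k) = act A 1 (o k) := by
            rw [hdn]
            simp only [o, Function.iterate_succ_apply']
          rw [this, ← act_add]
          congr 2
          push_cast
          ring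
      have h1 := ((hsum fun k => dig (o k)).hasSum.tendsto_sum_nat).add
        (hzero (fun k => (o k : KSpace A)) fun k => (o k).2)
      rw [add_zero] at h1
      refine tendsto_nhds_unique h1 ?_
      simp_rw [← hpart]
      exact tendsto_const_nhds
    · rintro _ ⟨d, rfl⟩
      obtain ⟨x0, hx0⟩ := hX
      have hback : ∀ p ∈ X, ∀ e : E, act A (-1) (p + e) ∈ X := by
        intro p hp e
        have h1 : p + (e : KSpace A) ∈ act A 1 '' X := by
          rw [hXe]
          exact Set.mem_biUnion e.2 ⟨p, hp, rfl⟩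
        obtain ⟨q, hq, hqe⟩ := h1
        rw [← hqe, hinv]
        exact hq
      have hpart : ∀ (k : ℕ) (d : ℕ → E),
          ∑ j ∈ Finset.range k, t d j + act A (-(k : ℤ)) x0 ∈ X := by
        intro k
        induction k with
        | zero => intro d; simpa [act_zero] using hx0
        | succ k ih =>
          intro d
          have h1 := hback _ (ih fun j => d (j + 1)) (d 0)
          rw [map_add, map_add, map_sum, ← act_add] at h1
          convert h1 using 1
          rw [Finset.sum_range_succ', add_right_comm]
          congr 1
          congr 1
          · refine Finset.sum_congr rfl fun j _ => ?_
            change act A _ _ = act A _ (act A _ _)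
            rw [← act_add]
            congr 2
            push_cast
            ring
          · congr 2
            push_cast
            ring
      have h1 := ((hsum d).hasSum.tendsto_sum_nat).add (hzero (fun _ => x0) fun _ => hx0)
      rw [add_zero] at h1
      exact hXc.isClosed.mem_of_tendsto h1 (Eventually.of_forall fun k => hpart k d)

end Space

theorem aIndex_ne_zero {A : Matrix (Fin n) (Fin n) ℚ} (hA : IsUnit A.det) : aIndex A ≠ 0 := by
  have hP : polyLattice A = intLattice n ⊔ (polyLattice A).map (mulHom A) := by
    refine le_antisymm (iSup_le fun k => ?_)
      (sup_le (intLattice_le_polyLattice A) (map_polyLattice_le A))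
    cases k with
    | zero => simp [mulHom_one]
    | succ k =>
      refine le_trans ?_ le_sup_right
      rw [pow_succ', mulHom_mul, ← AddSubgroup.map_map]
      exact AddSubgroup.map_mono (le_iSup (fun k : ℕ => (intLattice n).map (mulHom (A ^ k))) k)
  have hrel : aIndex A = ((polyLattice A).map (mulHom A)).relIndex (intLattice n) := by
    rw [aIndex]
    calc _ = ((polyLattice A).map (mulHom A)).relIndex
          (intLattice n ⊔ (polyLattice A).map (mulHom A)) := by rw [← hP]
      _ = _ := AddSubgroup.relIndex_sup_right _ _
  rw [hrel]
  let m : ℕ := ∏ i, ∏ j, (A⁻¹ i j).den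
  have hm : m ≠ 0 := Finset.prod_ne_zero_iff.2 fun i _ =>
    Finset.prod_ne_zero_iff.2 fun j _ => (A⁻¹ i j).den_nz
  have hint : ∀ i j, ∃ c : ℤ, (c : ℚ) = m * A⁻¹ i j := by
    intro i j
    obtain ⟨c, hc⟩ : (A⁻¹ i j).den ∣ m :=
      (Finset.dvd_prod_of_mem (fun j => (A⁻¹ i j).den) (Finset.mem_univ j)).trans
        (Finset.dvd_prod_of_mem (fun i => ∏ j, (A⁻¹ i j).den) (Finset.mem_univ i))
    refine ⟨c * (A⁻¹ i j).num, ?_⟩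
    rw [hc]
    push_cast
    rw [mul_comm ((A⁻¹ i j).den : ℚ), mul_assoc, Rat.den_mul_eq_num]
  have hmul : ∀ z ∈ intLattice n, m • z ∈ (polyLattice A).map (mulHom A) := by
    intro z hz
    refine ⟨mulHom A⁻¹ (m • z), intLattice_le_polyLattice A ?_, ?_⟩
    · rw [mem_intLattice] at hz ⊢
      choose w hw using hz
      choose c hc using hint
      intro i
      refine ⟨∑ j, c i j * w j, ?_⟩
      push_cast
      rw [mulHom_apply, Matrix.mulVec, dotProduct]
      refine Finset.sum_congr rfl fun j _ => ?_
      rw [hc, hw]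
      simp
      ring
    · rw [← AddMonoidHom.comp_apply, ← mulHom_mul, Matrix.mul_nonsing_inv _ hA, mulHom_one]
      rfl
  have hfg : AddGroup.FG (intLattice n) := by
    let f : (Fin n → ℤ) →+ (Fin n → ℚ) := (Int.castAddHom ℚ).compLeft (Fin n)
    have hf : f.range = intLattice n := by
      ext x
      rw [mem_intLattice, AddMonoidHom.mem_range]
      constructor
      · rintro ⟨w, rfl⟩ i
        exact ⟨w i, rfl⟩
      · intro h
        choose w hw using h
        exact ⟨w, funext hw⟩
    have hfgZ : AddGroup.FG (Fin n → ℤ) := Module.Finite.iff_addGroup_fg.1 inferInstance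
    rw [← hf]
    exact AddGroup.fg_of_surjective f.rangeRestrict_surjective
  have htor : IsAddTorsion
      (intLattice n ⧸ ((polyLattice A).map (mulHom A)).addSubgroupOf (intLattice n)) := by
    intro q
    induction q using QuotientAddGroup.induction_on with
    | H z =>
      rw [isOfFinAddOrder_iff_nsmul_eq_zero]
      refine ⟨m, Nat.pos_of_ne_zero hm, ?_⟩
      rw [← QuotientAddGroup.mk_nsmul, QuotientAddGroup.eq_zero_iff,
        AddSubgroup.mem_addSubgroupOf]
      exact hmul z z.2
  have : AddGroup.FG
      (intLattice n ⧸ ((polyLattice A).map (mulHom A)).addSubgroupOf (intLattice n)) :=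
    AddGroup.fg_of_surjective (QuotientAddGroup.mk'_surjective _)
  have := AddCommGroup.finite_of_fg_isAddTorsion _ htor
  exact Nat.card_ne_zero.2 ⟨inferInstance, this⟩

section Tile

variable (A : Matrix (Fin n) (Fin n) ℚ) [hA : Fact (IsExpanding A)] [hb : Fact (2 ≤ bIndex A)]

/-- `D` is a digit set for the base `A`: `D ⊆ ℤⁿ[A]` and `|D| = |ℤⁿ[A] / A ℤⁿ[A]|`. -/
structure IsDigitSet {n : ℕ} (A : Matrix (Fin n) (Fin n) ℚ) (D : Finset (Fin n → ℚ)) : Prop where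
  mem_polyLattice : ∀ d ∈ D, d ∈ polyLattice A
  card_eq : D.card = aIndex A

/-- `F` is nonempty and compact and satisfies the set equation `A F = ⋃_{d ∈ D} (F + φ(d))`. -/
def IsSelfAffine (D : Finset (Fin n → ℚ)) (F : Set (KSpace A)) : Prop :=
  F.Nonempty ∧ IsCompact F ∧ act A 1 '' F = ⋃ p ∈ phiImage A (D : Set (Fin n → ℚ)), translate F p

theorem existsUnique_isSelfAffine {D : Finset (Fin n → ℚ)} (hD : IsDigitSet A D) :
    ∃! F, IsSelfAffine A D F := by
  refine existsUnique_of_finite A (phiImage A D) (Set.Finite.image _ ?_) ?_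
  · exact D.finite_toSet.preimage Subtype.val_injective.injOn
  · have hne : D.Nonempty := by
      rw [← Finset.card_pos, hD.card_eq]
      exact Nat.pos_of_ne_zero (aIndex_ne_zero hA.out.isUnit_det)
    obtain ⟨d, hd⟩ := hne
    exact ⟨_, ⟨d, polyLattice_le A (hD.mem_polyLattice d hd)⟩, hd, rfl⟩

variable {A}

/-- The set `F = F(A, D)`: the unique nonempty compact subset of `𝕂_A` with
`A F = ⋃_{d ∈ D} (F + φ(d))`. -/
def tile {D : Finset (Fin n → ℚ)} (hD : IsDigitSet A D) : Set (KSpace A) :=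
  (existsUnique_isSelfAffine A hD).choose

theorem tile_spec {D : Finset (Fin n → ℚ)} (hD : IsDigitSet A D) :
    IsSelfAffine A D (tile hD) :=
  (existsUnique_isSelfAffine A hD).choose_spec.1

theorem tile_unique {D : Finset (Fin n → ℚ)} (hD : IsDigitSet A D) {F : Set (KSpace A)}
    (hF : IsSelfAffine A D F) : F = tile hD :=
  (existsUnique_isSelfAffine A hD).choose_spec.2 F hF

/-- `D_k = {d₀ + A d₁ + ⋯ + A ^ (k - 1) d_{k - 1} | d₀, …, d_{k - 1} ∈ D}`. -/
def blocks {n : ℕ} (A : Matrix (Fin n) (Fin n) ℚ) (D : Finset (Fin n → ℚ)) (k : ℕ) :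
    Set (Fin n → ℚ) :=
  {x | ∃ d : Fin k → Fin n → ℚ, (∀ i, d i ∈ D) ∧ x = ∑ i : Fin k, mulHom (A ^ (i : ℕ)) (d i)}

variable (A) in
/-- `Δ = ⋃_{k ≥ 1} φ(D_k - D_k)`. -/
def delta (D : Finset (Fin n → ℚ)) : Set (KSpace A) :=
  ⋃ k : ℕ, ⋃ _ : 1 ≤ k, phiImage A (blocks A D k - blocks A D k)

/-! ### Tilings -/

/-- `F + S` is a tiling of `𝕂_A`: it covers `𝕂_A`, and distinct translates intersect in a
null set. -/
structure IsTiling (F S : Set (KSpace A)) : Prop where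
  covers : ⋃ s ∈ S, translate F s = Set.univ
  null_inter : ∀ s ∈ S, ∀ s' ∈ S, s ≠ s' → mu A (translate F s ∩ translate F s') = 0

/-- An expanding linear map of `𝕂_A`: a bijective continuous additive map that commutes with the
action of `A` and whose iterates expand all distances at a common exponential rate. -/
structure IsExpandingLinear (T : KSpace A →+ KSpace A) : Prop where
  continuous : Continuous T
  bijective : Function.Bijective T
  commutes : ∀ p, T (act A 1 p) = act A 1 (T p)
  expands : ∃ c r : ℝ, 0 < c ∧ 1 < r ∧
    ∀ (m : ℕ) (p q : KSpace A), c * r ^ m * dist p q ≤ dist (T^[m] p) (T^[m] q)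

/-- `F + S` is a self-replicating tiling of `𝕂_A` with associated expanding linear map `T`. -/
structure IsSelfReplicating (T : KSpace A →+ KSpace A) (F S : Set (KSpace A)) : Prop where
  isTiling : IsTiling F S
  isExpandingLinear : IsExpandingLinear T
  exists_finite : ∀ s ∈ S, ∃ J : Set (KSpace A), J ⊆ S ∧ J.Finite ∧
    T '' translate F s = ⋃ s' ∈ J, translate F s'

/-- `F + S` is an atomic self-replicating tiling: the origin lies in exactly one tile. -/
structure IsAtomicSelfReplicating (T : KSpace A →+ KSpace A) (F S : Set (KSpace A)) : Prop
    extends IsSelfReplicating T F S where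
  atomic : ∃! s, s ∈ S ∧ 0 ∈ translate F s

end Tile

end RationalTile

end

/-!
Counting indices of the lattices `ℤⁿ + ⋯ + A ^ k ℤⁿ` gives `a = |det A| * b`. As `A` scales `λ` by
`|det A|` and `μ_B` by `b`, it scales `μ` by exactly `a`. Hence the at most `a ^ k` translates of
`F` in `A ^ k F = F + φ(D_k)` are too few to overlap in positive measure.

If `F` has interior, that interior contains some small piece `A ^ (-k) (F + φ(d))`, `d ∈ D_k`, of
`F`, and the contraction that maps `F` onto this piece has a fixed point `x`. Since `x` is interior
and `A ^ k x = x + φ(d)`, the sets `A ^ (k m) (F - x)` increase to the whole space, and each of them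
is a union of measure disjoint translates of `F`. The union over `m` of these families is the atomic
self-replicating tiling, and its translate by `x` lies in `Δ`.
-/

open scoped Function ENNReal NNReal
open Multiplicative (ofAdd)

noncomputable section

namespace RationalTile

variable {n : ℕ}

section IndexFormula

variable {V : Type*} [AddCommGroup V] [Module ℚ V]

theorem exists_basis_closure_eq [Module.Finite ℚ V] (L : AddSubgroup V)
    [L.toIntSubmodule.IsLattice ℚ] :
    ∃ b : Module.Basis (Fin (Module.finrank ℚ V)) ℚ V, L = .closure (range b) := by
  let b := Module.Free.chooseBasis ℤ L.toIntSubmodule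
  let e := b.extendOfIsLattice ℚ
  refine ⟨e.reindex (Fintype.equivFinOfCardEq (Module.finrank_eq_card_basis e).symm), ?_⟩
  have hb : range e = (L.toIntSubmodule).subtype '' range b := by
    rw [← range_comp]
    exact congrArg range (funext fun i => b.extendOfIsLattice_apply ℚ i)
  apply AddSubgroup.toIntSubmodule.injective
  rw [AddSubgroup.toIntSubmodule_closure, Module.Basis.range_reindex, hb,
    ← Submodule.map_span, b.span_eq, Submodule.map_subtype_top]

theorem relIndex_map_eq_abs_det_mul [Module.Finite ℚ V] {f : V →ₗ[ℚ] V}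
    (hf : LinearMap.det f ≠ 0) {L L' : AddSubgroup V} [L.toIntSubmodule.IsLattice ℚ]
    [L'.toIntSubmodule.IsLattice ℚ] (h : L ≤ L') (hmap : L.map f.toAddMonoidHom ≤ L') :
    ((L.map f.toAddMonoidHom).relIndex L' : ℚ) = |LinearMap.det f| * L.relIndex L' := by
  obtain ⟨b, hb⟩ := exists_basis_closure_eq L
  obtain ⟨b', hb'⟩ := exists_basis_closure_eq L'
  let c := b.map (f.equivOfDetNeZero hf)
  have hc : L.map f.toAddMonoidHom = .closure (range c) := by
    rw [hb, AddMonoidHom.map_closure, ← range_comp]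
    rfl
  rw [AddSubgroup.relIndex_eq_abs_det _ _ h b b' hb hb',
    AddSubgroup.relIndex_eq_abs_det _ _ hmap c b' hc hb', ← abs_mul, ← b'.det_comp]
  rfl

end IndexFormula

/-- The lattice `ℤⁿ + M ℤⁿ + ⋯ + M ^ k ℤⁿ`; these exhaust `ℤⁿ[M]`. -/
def partLattice (M : Matrix (Fin n) (Fin n) ℚ) : ℕ →o AddSubgroup (Fin n → ℚ) :=
  partialSups fun i => (intLattice n).map (mulHom (M ^ i))

section PartLattice

variable (M : Matrix (Fin n) (Fin n) ℚ)

theorem partLattice_zero : partLattice M 0 = intLattice n := by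
  rw [partLattice, partialSups_zero, pow_zero, mulHom_one, AddSubgroup.map_id]

theorem partLattice_succ (k : ℕ) :
    partLattice M (k + 1) = partLattice M k ⊔ (intLattice n).map (mulHom (M ^ (k + 1))) :=
  partialSups_add_one _ k

theorem partLattice_succ' (k : ℕ) :
    partLattice M (k + 1) = intLattice n ⊔ (partLattice M k).map (mulHom M) := by
  induction k with
  | zero => rw [partLattice_succ, partLattice_zero, zero_add, pow_one]
  | succ k ih =>
    calc partLattice M (k + 2)
        = partLattice M (k + 1) ⊔ (intLattice n).map (mulHom (M ^ (k + 2))) :=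
          partLattice_succ M (k + 1)
      _ = intLattice n ⊔ ((partLattice M k).map (mulHom M) ⊔
            ((intLattice n).map (mulHom (M ^ (k + 1)))).map (mulHom M)) := by
          rw [ih, pow_succ' M (k + 1), mulHom_mul, AddSubgroup.map_map, sup_assoc]
      _ = intLattice n ⊔ (partLattice M (k + 1)).map (mulHom M) := by
          rw [← AddSubgroup.map_sup, ← partLattice_succ]

theorem iSup_partLattice : ⨆ k, partLattice M k = polyLattice M :=
  iSup_partialSups_eq _

theorem polyLattice_eq_sup : polyLattice M = intLattice n ⊔ (polyLattice M).map (mulHom M) := by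
  refine le_antisymm ?_ (sup_le (intLattice_le_polyLattice M) (map_polyLattice_le M))
  conv_lhs => rw [← iSup_partLattice]
  refine iSup_le fun k => ((partLattice M).mono k.le_succ).trans ?_
  rw [partLattice_succ', ← iSup_partLattice]
  exact sup_le_sup_left (AddSubgroup.map_mono (le_iSup (partLattice M) k)) _

theorem intLattice_eq_closure :
    intLattice n = AddSubgroup.closure (Set.range (Pi.basisFun ℚ (Fin n))) := by
  apply AddSubgroup.toIntSubmodule.injective
  rw [AddSubgroup.toIntSubmodule_closure]
  ext x
  rw [(Pi.basisFun ℚ (Fin n)).mem_span_iff_repr_mem ℤ]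
  exact mem_intLattice

theorem fg_partLattice (k : ℕ) : (partLattice M k).toIntSubmodule.FG := by
  have hmap (i : ℕ) : ((intLattice n).map (mulHom (M ^ i))).toIntSubmodule.FG := by
    rw [intLattice_eq_closure, AddMonoidHom.map_closure, AddSubgroup.toIntSubmodule_closure]
    exact Submodule.fg_span ((finite_range _).image _)
  induction k with
  | zero => exact hmap 0
  | succ k ih =>
    rw [partLattice_succ, OrderIso.map_sup]
    exact ih.sup (hmap (k + 1))

instance isLattice_partLattice (k : ℕ) : (partLattice M k).toIntSubmodule.IsLattice ℚ where
  fg := fg_partLattice M k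
  span_eq_top := by
    rw [eq_top_iff, ← (Pi.basisFun ℚ (Fin n)).span_eq]
    refine Submodule.span_mono (AddSubgroup.subset_closure.trans ?_)
    rw [← intLattice_eq_closure, ← partLattice_zero M]
    exact (partLattice M).mono k.zero_le

theorem exists_inf_map_polyLattice_le :
    ∃ k, intLattice n ⊓ (polyLattice M).map (mulHom M) ≤ (partLattice M k).map (mulHom M) := by
  have hfg : (intLattice n ⊓ (polyLattice M).map (mulHom M)).toIntSubmodule.FG :=
    (fg_partLattice M 0).of_le <| AddSubgroup.toIntSubmodule.monotone <|
      inf_le_left.trans_eq (partLattice_zero M).symm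
  have hle : (intLattice n ⊓ (polyLattice M).map (mulHom M)).toIntSubmodule ≤
      ⨆ k, ((partLattice M k).map (mulHom M)).toIntSubmodule := by
    rw [← OrderIso.map_iSup, ← AddSubgroup.map_iSup, iSup_partLattice]
    exact AddSubgroup.toIntSubmodule.monotone inf_le_right
  have hdir : Directed (· ≤ ·) fun k => ((partLattice M k).map (mulHom M)).toIntSubmodule :=
    Monotone.directed_le fun i j hij =>
      AddSubgroup.toIntSubmodule.monotone (AddSubgroup.map_mono ((partLattice M).mono hij))
  rw [Submodule.fg_iff_compact,
    CompleteLattice.isCompactElement_iff_le_of_directed_sSup_le] at hfg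
  obtain ⟨_, ⟨k, rfl⟩, hk⟩ := hfg (range _) (range_nonempty _) hdir.directedOn_range hle
  exact ⟨k, hk⟩

theorem eventually_relIndex_map_partLattice :
    ∀ᶠ k in atTop,
      ((partLattice M k).map (mulHom M)).relIndex (partLattice M (k + 1)) = aIndex M := by
  obtain ⟨k₀, hk₀⟩ := exists_inf_map_polyLattice_le M
  filter_upwards [eventually_ge_atTop k₀] with k hk
  have h : intLattice n ⊓ (partLattice M k).map (mulHom M) =
      intLattice n ⊓ (polyLattice M).map (mulHom M) := by
    refine le_antisymm (inf_le_inf_left _ (AddSubgroup.map_mono ?_)) (le_inf inf_le_left ?_)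
    · exact (le_iSup (partLattice M) k).trans_eq (iSup_partLattice M)
    · exact hk₀.trans (AddSubgroup.map_mono ((partLattice M).mono hk))
  calc ((partLattice M k).map (mulHom M)).relIndex (partLattice M (k + 1))
      = (intLattice n ⊓ (partLattice M k).map (mulHom M)).relIndex (intLattice n) := by
        rw [partLattice_succ', AddSubgroup.relIndex_sup_right, AddSubgroup.inf_relIndex_left]
    _ = ((polyLattice M).map (mulHom M)).relIndex
          (intLattice n ⊔ (polyLattice M).map (mulHom M)) := by
        rw [h, AddSubgroup.relIndex_sup_right, AddSubgroup.inf_relIndex_left]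
    _ = aIndex M := by rw [← polyLattice_eq_sup, aIndex]

end PartLattice

theorem mulHom_injective {M : Matrix (Fin n) (Fin n) ℚ} (hM : IsUnit M.det) :
    Function.Injective (mulHom M) :=
  Matrix.mulVec_injective_iff_isUnit.2 ((Matrix.isUnit_iff_isUnit_det M).2 hM)

theorem map_pow_partLattice_inv {A : Matrix (Fin n) (Fin n) ℚ} (hA : IsUnit A.det) (k : ℕ) :
    (partLattice A⁻¹ k).map (mulHom (A ^ k)) = partLattice A k := by
  induction k with
  | zero => rw [pow_zero, mulHom_one, AddSubgroup.map_id, partLattice_zero, partLattice_zero]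
  | succ k ih =>
    rw [partLattice_succ', AddSubgroup.map_sup, AddSubgroup.map_map, ← mulHom_mul, pow_succ,
      mul_assoc, Matrix.mul_nonsing_inv _ hA, mul_one, ih, sup_comm, ← pow_succ,
      ← partLattice_succ]

/-- For large `k`, with `P k = ℤⁿ + ⋯ + A⁻ᵏ ℤⁿ`, the index of `P k` in `P (k + 1)` is `a`, and that
of `A⁻¹ P k` is `b`. -/
theorem aIndex_eq_abs_det_mul_bIndex {A : Matrix (Fin n) (Fin n) ℚ} (hA : IsUnit A.det) :
    (aIndex A : ℚ) = |A.det| * bIndex A := by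
  obtain ⟨k, ha, hb⟩ :=
    ((eventually_relIndex_map_partLattice A).and (eventually_relIndex_map_partLattice A⁻¹)).exists
  have ha' : (partLattice A⁻¹ k).relIndex (partLattice A⁻¹ (k + 1)) = aIndex A := by
    rw [← ha, ← map_pow_partLattice_inv hA, ← map_pow_partLattice_inv hA, AddSubgroup.map_map,
      ← mulHom_mul, ← pow_succ', AddSubgroup.relIndex_map_map_of_injective]
    exact mulHom_injective (by rw [Matrix.det_pow]; exact hA.pow _)
  have hind := relIndex_map_eq_abs_det_mul (f := Matrix.toLin' A⁻¹)
    (by rw [LinearMap.det_toLin', Matrix.det_nonsing_inv]; exact hA.ringInverse.ne_zero)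
    ((partLattice A⁻¹).mono k.le_succ) (by rw [partLattice_succ']; exact le_sup_right)
  rw [LinearMap.det_toLin', Matrix.det_nonsing_inv, Ring.inverse_eq_inv', abs_inv, ha'] at hind
  rw [eq_comm, ← eq_inv_mul_iff_mul_eq₀ (abs_ne_zero.2 hA.ne_zero), ← hind]
  exact congrArg Nat.cast hb.symm

theorem pairwise_aedisjoint_of_sum_measure_le {α ι : Type*} [MeasurableSpace α] {μ : Measure α}
    {s : Finset ι} {t : ι → Set α} (ht : ∀ i ∈ s, NullMeasurableSet (t i) μ)
    (hfin : ∀ i ∈ s, μ (t i) ≠ ∞) (hle : ∑ i ∈ s, μ (t i) ≤ μ (⋃ i ∈ s, t i)) :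
    (s : Set ι).Pairwise (AEDisjoint μ on t) := by
  classical
  intro i hi j hj hij
  have hcover : ⋃ k ∈ s, t k ⊆ (t i \ t j) ∪ ⋃ k ∈ s.erase i, t k := by
    refine iUnion₂_subset fun k hk x hx => ?_
    by_cases hxi : x ∈ t i \ t j
    · exact .inl hxi
    obtain ⟨l, hl, hli, hxl⟩ : ∃ l ∈ s, l ≠ i ∧ x ∈ t l := by
      rcases eq_or_ne k i with rfl | hki
      · exact ⟨j, hj, hij.symm, by_contra fun h => hxi ⟨hx, h⟩⟩
      · exact ⟨k, hk, hki, hx⟩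
    exact .inr (mem_biUnion (Finset.mem_erase.2 ⟨hli, hl⟩) hxl)
  have hsum : μ (t i) + ∑ k ∈ s.erase i, μ (t k) ≤ μ (t i \ t j) + ∑ k ∈ s.erase i, μ (t k) :=
    calc μ (t i) + ∑ k ∈ s.erase i, μ (t k) = ∑ k ∈ s, μ (t k) :=
          Finset.add_sum_erase s (μ <| t ·) hi
      _ ≤ μ (⋃ k ∈ s, t k) := hle
      _ ≤ μ (t i \ t j) + μ (⋃ k ∈ s.erase i, t k) :=
        (measure_mono hcover).trans (measure_union_le _ _)
      _ ≤ _ := by gcongr; exact measure_biUnion_finset_le _ _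
  have hdiff : μ (t i) ≤ μ (t i \ t j) :=
    (ENNReal.add_le_add_iff_right <| ENNReal.sum_ne_top.2 fun k hk =>
      hfin k (Finset.mem_of_mem_erase hk)).1 hsum
  rw [← measure_inter_add_sdiff₀ (t i) (ht j hj)] at hdiff
  have hne : μ (t i \ t j) ≠ ∞ := measure_ne_top_of_subset sdiff_subset (hfin i hi)
  exact nonpos_iff_eq_zero.1 ((ENNReal.add_le_add_iff_right hne).1 (by rwa [zero_add]))

theorem disjoint_interior_of_aedisjoint {α : Type*} [TopologicalSpace α] [MeasurableSpace α]
    {μ : Measure α} [μ.IsOpenPosMeasure] {s t : Set α} (h : AEDisjoint μ s t) :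
    Disjoint (interior s) (interior t) := by
  rw [disjoint_iff_inter_eq_empty]
  exact (isOpen_interior.inter isOpen_interior).eq_empty_of_measure_zero <|
    measure_mono_null (inter_subset_inter interior_subset interior_subset) h

theorem pairwise_aedisjoint_vadd {G : Type*} [AddCommGroup G] [MeasurableSpace G]
    {μ : Measure G} [μ.IsAddLeftInvariant] [MeasurableAdd G] {F S : Set G}
    (h : S.Pairwise (AEDisjoint μ on (· +ᵥ F))) (c : G) :
    (c +ᵥ S).Pairwise (AEDisjoint μ on (· +ᵥ F)) := by
  rintro _ ⟨s, hs, rfl⟩ _ ⟨t, ht, rfl⟩ hst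
  have := h hs ht (fun h => hst (h ▸ rfl))
  rw [Function.onFun, AEDisjoint] at this ⊢
  rw [← measure_vadd μ c] at this
  simpa only [vadd_set_inter, vadd_assoc] using this

theorem aedisjoint_vadd_of_sub_mem_sub {G : Type*} [AddCommGroup G] [MeasurableSpace G]
    [MeasurableAdd G] {μ : Measure G} [μ.IsAddLeftInvariant] {E F : Set G} {s t : G}
    (h : E.Pairwise (AEDisjoint μ on (· +ᵥ F))) (hst : s - t ∈ E - E) (hne : s ≠ t) :
    AEDisjoint μ (s +ᵥ F) (t +ᵥ F) := by
  obtain ⟨p, hp, q, hq, hpq⟩ := hst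
  refine pairwise_aedisjoint_vadd h (s - p) ⟨p, hp, sub_add_cancel s p⟩ ⟨q, hq, ?_⟩ hne
  have hpq' : p - q = s - t := hpq
  change s - p + q = t
  rw [sub_add, hpq', sub_sub_cancel]

section DigitSums

variable {Γ G : Type*} [Group Γ] [AddCommGroup G] [DistribMulAction Γ G]

/-- The sums `d₀ + γ d₁ + ⋯ + γ ^ (k - 1) d_{k - 1}` with all `dᵢ ∈ E`. -/
def digitSums (γ : Γ) (E : Set G) (k : ℕ) : Set G := ∑ i ∈ Finset.range k, γ ^ i • E

variable (γ : Γ) (E : Set G)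

theorem digitSums_zero : digitSums γ E 0 = 0 := rfl

theorem digitSums_succ (k : ℕ) : digitSums γ E (k + 1) = digitSums γ E k + γ ^ k • E :=
  Finset.sum_range_succ _ k

theorem digitSums_succ' (k : ℕ) : digitSums γ E (k + 1) = E + γ • digitSums γ E k := by
  simp only [digitSums, Finset.sum_range_succ', pow_succ', mul_smul, pow_zero, one_smul,
    Finset.smul_sum, add_comm]

theorem digitSums_add (j k : ℕ) :
    digitSums γ E (j + k) = digitSums γ E j + γ ^ j • digitSums γ E k := by
  simp only [digitSums, Finset.sum_range_add, pow_add, mul_smul, Finset.smul_sum]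

theorem digitSums_pow (k m : ℕ) :
    digitSums (γ ^ k) (digitSums γ E k) m = digitSums γ E (k * m) := by
  induction m with
  | zero => rfl
  | succ m ih => rw [digitSums_succ, ih, Nat.mul_succ, digitSums_add, pow_mul]

variable {E} in
theorem finite_digitSums (hE : E.Finite) (k : ℕ) : (digitSums γ E k).Finite := by
  induction k with
  | zero => exact finite_zero
  | succ k ih => exact digitSums_succ γ E k ▸ ih.add hE.smul_set

theorem ncard_digitSums_le (k : ℕ) : (digitSums γ E k).ncard ≤ E.ncard ^ k := by
  induction k with
  | zero => exact (ncard_singleton (0 : G)).le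
  | succ k ih =>
    rw [digitSums_succ, pow_succ]
    refine Set.natCard_add_le.trans (Nat.mul_le_mul ih ?_)
    exact (Set.ncard_smul_set _ _).le

variable {γ E} in
theorem pow_smul_eq_digitSums_add {F : Set G} (h : γ • F = E + F) (k : ℕ) :
    γ ^ k • F = digitSums γ E k + F := by
  induction k with
  | zero => rw [pow_zero, one_smul, digitSums_zero, zero_add]
  | succ k ih => rw [pow_succ, mul_smul, h, smul_add, ih, digitSums_succ, ← add_assoc,
      add_comm (γ ^ k • E)]

end DigitSums

section Inflation

variable {Γ G : Type*} [Group Γ] [AddCommGroup G] [DistribMulAction Γ G] {γ : Γ} {E : Set G}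
  {d x : G}

/-- The translates of `F` that make up the inflation `γ ^ m (F - x)` of a self-affine tile `F`. -/
def inflationLevel (γ : Γ) (E : Set G) (x : G) (m : ℕ) : Set G :=
  -(γ ^ m • x) +ᵥ digitSums γ E m

/-- The translates of a self-affine tile `F` that make up `⋃ m, γ ^ m (F - x)`. When `x ∈ F` is
fixed by one of the maps `p ↦ γ⁻¹ (d + p)`, `d ∈ E`, this union is increasing. -/
def inflationTranslates (γ : Γ) (E : Set G) (x : G) : Set G :=
  ⋃ m, inflationLevel γ E x m

theorem inflationLevel_zero : inflationLevel γ E x 0 = {-x} := by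
  rw [inflationLevel, digitSums_zero, pow_zero, one_smul, ← singleton_zero, vadd_set_singleton,
    vadd_eq_add, add_zero]

theorem neg_mem_inflationTranslates : -x ∈ inflationTranslates γ E x :=
  mem_iUnion.2 ⟨0, by rw [inflationLevel_zero]; rfl⟩

theorem inflationLevel_mono (hd : d ∈ E) (hx : γ • x = d + x) :
    Monotone (inflationLevel γ E x) := by
  refine monotone_nat_of_le_succ fun m => ?_
  rintro _ ⟨p, hp, rfl⟩
  refine ⟨p + γ ^ m • d, ?_, ?_⟩
  · rw [digitSums_succ]
    exact add_mem_add hp (smul_mem_smul_set hd)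
  · simp only [vadd_eq_add, pow_succ, mul_smul, hx, smul_add]
    abel

theorem smul_inflationLevel_add (m : ℕ) :
    γ • inflationLevel γ E x m + E = inflationLevel γ E x (m + 1) := by
  rw [inflationLevel, inflationLevel, digitSums_succ', ← singleton_vadd, ← singleton_vadd,
    vadd_eq_add, vadd_eq_add, smul_add, smul_set_singleton, smul_neg, smul_smul, ← pow_succ',
    add_assoc, add_comm E]

theorem vadd_inflationLevel_subset (hd : d ∈ E) (hx : γ • x = d + x) (m : ℕ) :
    x +ᵥ inflationLevel γ E x m ⊆ digitSums γ E m - digitSums γ E m := by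
  have horbit : γ ^ m • x - x ∈ digitSums γ E m := by
    induction m with
    | zero => simp [digitSums_zero]
    | succ m ih =>
      have : γ ^ (m + 1) • x - x = (γ ^ m • x - x) + γ ^ m • d := by
        rw [pow_succ, mul_smul, hx, smul_add]
        abel
      rw [this, digitSums_succ]
      exact add_mem_add ih (smul_mem_smul_set hd)
  rintro _ ⟨_, ⟨p, hp, rfl⟩, rfl⟩
  refine ⟨p, hp, _, horbit, ?_⟩
  simp only [vadd_eq_add]
  abel

theorem smul_vadd_subset_inflationTranslates {s : G} (hs : s ∈ inflationTranslates γ E x) :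
    γ • s +ᵥ E ⊆ inflationTranslates γ E x := by
  obtain ⟨m, hm⟩ := mem_iUnion.1 hs
  refine (vadd_set_subset_add (smul_mem_smul_set hm)).trans ?_
  rw [smul_inflationLevel_add]
  exact subset_iUnion _ (m + 1)

theorem vadd_inflationTranslates_subset (hd : d ∈ E) (hx : γ • x = d + x) :
    x +ᵥ inflationTranslates γ E x ⊆ ⋃ m ≥ 1, (digitSums γ E m - digitSums γ E m) := by
  rw [inflationTranslates, vadd_set_iUnion]
  refine iUnion_subset fun m => ?_
  calc x +ᵥ inflationLevel γ E x m ⊆ x +ᵥ inflationLevel γ E x (m + 1) :=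
        vadd_set_mono (inflationLevel_mono hd hx m.le_succ)
    _ ⊆ digitSums γ E (m + 1) - digitSums γ E (m + 1) := vadd_inflationLevel_subset hd hx (m + 1)
    _ ⊆ _ := subset_iUnion₂_of_subset (m + 1) m.succ_pos subset_rfl

end Inflation

section SelfAffineTile

variable {Γ G : Type*} [Group Γ] [NormedAddCommGroup G] [DistribMulAction Γ G]

/-- The powers of `γ` eventually expand all distances by an arbitrarily large factor. -/
def IsUniformlyExpanding (G : Type*) [NormedAddCommGroup G] [DistribMulAction Γ G] (γ : Γ) : Prop :=
  ∀ ε > 0, ∀ᶠ k : ℕ in atTop, ∀ p : G, ‖(γ ^ k)⁻¹ • p‖ ≤ ε * ‖p‖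

theorem IsUniformlyExpanding.tendsto_inv_pow_smul {γ : Γ} (hγ : IsUniformlyExpanding G γ) (p : G) :
    Tendsto (fun k : ℕ => (γ ^ k)⁻¹ • p) atTop (𝓝 0) := by
  rw [NormedAddGroup.tendsto_nhds_zero]
  intro ε hε
  filter_upwards [hγ (ε / (‖p‖ + 1)) (by positivity)] with k hk
  refine (hk p).trans_lt ?_
  rw [div_mul_eq_mul_div, div_lt_iff₀ (by positivity)]
  gcongr
  exact lt_add_one _

theorem IsUniformlyExpanding.pow {γ : Γ} (hγ : IsUniformlyExpanding G γ) {k : ℕ} (hk : 1 ≤ k) :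
    IsUniformlyExpanding G (γ ^ k) := fun ε hε => by
  simpa only [id, pow_mul] using (tendsto_id.const_mul_atTop' hk).eventually (hγ ε hε)

variable [ContinuousConstSMul Γ G]

/-- A compact set that `γ` maps onto the union of its translates by `E`, where `E` has at most as
many elements as `γ` scales Haar measure. -/
structure IsSelfAffineTile [LocallyCompactSpace G] (γ : Γ) (E F : Set G) : Prop where
  finite : E.Finite
  ncard_le : (E.ncard : ℝ≥0) ≤ distribHaarChar G γ
  isCompact : IsCompact F
  smul_eq : γ • F = E + F

namespace IsSelfAffineTile

variable [LocallyCompactSpace G] {γ : Γ} {E F : Set G}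

theorem pow (h : IsSelfAffineTile γ E F) (k : ℕ) :
    IsSelfAffineTile (γ ^ k) (digitSums γ E k) F where
  finite := finite_digitSums γ h.finite k
  ncard_le :=
    calc ((digitSums γ E k).ncard : ℝ≥0) ≤ (E.ncard : ℝ≥0) ^ k :=
          mod_cast ncard_digitSums_le γ E k
      _ ≤ distribHaarChar G γ ^ k := by gcongr; exact h.ncard_le
      _ = distribHaarChar G (γ ^ k) := (map_pow _ _ _).symm
  isCompact := h.isCompact
  smul_eq := pow_smul_eq_digitSums_add h.smul_eq k

theorem exists_mem_digitSums (h : IsSelfAffineTile γ E F) (k : ℕ) {p : G} (hp : p ∈ F) :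
    ∃ d ∈ digitSums γ E k, p ∈ (γ ^ k)⁻¹ • (d +ᵥ F) := by
  have hp' : γ ^ k • p ∈ digitSums γ E k + F := (h.pow k).smul_eq ▸ smul_mem_smul_set hp
  obtain ⟨d, hd, q, hq, hdq⟩ := hp'
  exact ⟨d, hd, mem_inv_smul_set_iff.2 (hdq ▸ vadd_mem_vadd_set hq)⟩

theorem inv_pow_smul_vadd_subset (h : IsSelfAffineTile γ E F) {k : ℕ} {d : G}
    (hd : d ∈ digitSums γ E k) : (γ ^ k)⁻¹ • (d +ᵥ F) ⊆ F := by
  rw [smul_set_subset_iff_subset_inv_smul_set, inv_inv, (h.pow k).smul_eq]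
  exact vadd_set_subset_add hd

theorem eventually_exists_piece_subset_ball (h : IsSelfAffineTile γ E F)
    (hγ : IsUniformlyExpanding G γ) {p : G} (hp : p ∈ F) {ε : ℝ} (hε : 0 < ε) :
    ∀ᶠ k in atTop, ∃ d ∈ digitSums γ E k,
      (γ ^ k)⁻¹ • (d +ᵥ F) ⊆ F ∩ Metric.ball p ε := by
  have hδ : 0 < ε / (Metric.diam F + 1) := by positivity
  filter_upwards [hγ _ hδ] with k hk
  obtain ⟨d, hd, hpd⟩ := h.exists_mem_digitSums k hp
  refine ⟨d, hd, subset_inter (h.inv_pow_smul_vadd_subset hd) ?_⟩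
  obtain ⟨_, ⟨q, hq, rfl⟩, rfl⟩ := hpd
  rintro _ ⟨_, ⟨r, hr, rfl⟩, rfl⟩
  rw [Metric.mem_ball, dist_eq_norm]
  calc ‖(γ ^ k)⁻¹ • (d +ᵥ r) - (γ ^ k)⁻¹ • (d +ᵥ q)‖
      = ‖(γ ^ k)⁻¹ • (r - q)‖ := by
        rw [← smul_sub, vadd_eq_add, vadd_eq_add, add_sub_add_left_eq_sub]
    _ ≤ ε / (Metric.diam F + 1) * ‖r - q‖ := hk _
    _ ≤ ε / (Metric.diam F + 1) * Metric.diam F := by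
        gcongr
        rw [← dist_eq_norm]
        exact Metric.dist_le_diam_of_mem h.isCompact.isBounded hr hq
    _ < ε := by
        rw [div_mul_eq_mul_div, div_lt_iff₀ (by positivity)]
        gcongr
        exact lt_add_one _

theorem subset_closure_interior (h : IsSelfAffineTile γ E F) (hγ : IsUniformlyExpanding G γ)
    (hF : (interior F).Nonempty) : F ⊆ closure (interior F) := by
  intro p hp
  rw [Metric.mem_closure_iff]
  intro ε hε
  obtain ⟨k, d, -, hd⟩ := (h.eventually_exists_piece_subset_ball hγ hp hε).exists
  obtain ⟨q, hq⟩ := hF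
  have hpiece : (γ ^ k)⁻¹ • (d +ᵥ interior F) ⊆ interior ((γ ^ k)⁻¹ • (d +ᵥ F)) := by
    rw [interior_smul, interior_vadd]
  have hmem : (γ ^ k)⁻¹ • (d +ᵥ q) ∈ interior (F ∩ Metric.ball p ε) :=
    interior_mono hd (hpiece (smul_mem_smul_set (vadd_mem_vadd_set hq)))
  rw [interior_inter] at hmem
  exact ⟨_, hmem.1, Metric.mem_ball'.1 (interior_subset hmem.2)⟩

theorem exists_periodic_mem_interior (h : IsSelfAffineTile γ E F) (hγ : IsUniformlyExpanding G γ)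
    (hF : (interior F).Nonempty) :
    ∃ k ≥ 1, ∃ d ∈ digitSums γ E k, ∃ x ∈ interior F, γ ^ k • x = d + x := by
  obtain ⟨p, hp⟩ := hF
  obtain ⟨ε, hε, hball⟩ := Metric.isOpen_iff.1 isOpen_interior p hp
  obtain ⟨k, ⟨d, hd, hsub⟩, hk, hk1⟩ :=
    ((h.eventually_exists_piece_subset_ball hγ (interior_subset hp) hε).and
      ((hγ (1 / 2) (by norm_num)).and (eventually_ge_atTop 1))).exists
  let g : G → G := fun q => (γ ^ k)⁻¹ • (d + q)
  have hgF : MapsTo g F (F ∩ Metric.ball p ε) := fun q hq =>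
    hsub (smul_mem_smul_set (vadd_mem_vadd_set hq))
  have hg : LipschitzWith (1 / 2) g := LipschitzWith.of_dist_le_mul fun q r => by
    simpa [g, dist_eq_norm, ← smul_sub] using hk (q - r)
  have hgF' : MapsTo g F F := fun q hq => (hgF hq).1
  obtain ⟨x, hx, hfix, -⟩ := ContractingWith.exists_fixedPoint' h.isCompact.isComplete hgF'
    ⟨NNReal.half_lt_self one_ne_zero, hg.lipschitzOnWith.mapsToRestrict hgF'⟩ (interior_subset hp)
    (edist_ne_top _ _)
  refine ⟨k, hk1, d, hd, x, hball ?_, inv_smul_eq_iff.1 hfix |>.symm⟩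
  exact hfix ▸ (hgF hx).2

section Measure

variable [MeasurableSpace G] [BorelSpace G] {μ : Measure G} [μ.IsAddHaarMeasure] [μ.Regular]

theorem pairwise_aedisjoint (h : IsSelfAffineTile γ E F) :
    E.Pairwise (AEDisjoint μ on (· +ᵥ F)) := by
  lift E to Finset G using h.finite
  refine pairwise_aedisjoint_of_sum_measure_le
    (fun d _ => (h.isCompact.measurableSet.const_vadd d).nullMeasurableSet)
    (fun d _ => (h.isCompact.vadd d).measure_ne_top) ?_
  have hcard : (E.card : ℝ≥0) ≤ distribHaarChar G γ := by
    rw [← ncard_coe_finset]; exact h.ncard_le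
  calc ∑ d ∈ E, μ (d +ᵥ F) = (E.card : ℝ≥0) * μ F := by simp [measure_vadd]
    _ ≤ distribHaarChar G γ * μ F := by gcongr
    _ = μ (⋃ d ∈ E, d +ᵥ F) := by
        rw [distribHaarChar_mul, h.smul_eq, ← iUnion_add_left_image]
        rfl

end Measure

variable {d x : G}

theorem inflationTranslates_add_eq_univ (h : IsSelfAffineTile γ E F)
    (hγ : IsUniformlyExpanding G γ) (hx : x ∈ interior F) :
    inflationTranslates γ E x + F = univ := by
  refine eq_univ_of_forall fun q => ?_
  have hlim : Tendsto (fun m : ℕ => (γ ^ m)⁻¹ • q + x) atTop (𝓝 x) := by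
    simpa using (hγ.tendsto_inv_pow_smul q).add_const x
  obtain ⟨m, hm⟩ := (hlim.eventually (mem_interior_iff_mem_nhds.1 hx)).exists
  have hq : q + γ ^ m • x ∈ γ ^ m • F :=
    mem_smul_set_iff_inv_smul_mem.2 (by rwa [smul_add, inv_smul_smul])
  rw [(h.pow m).smul_eq] at hq
  obtain ⟨p, hp, r, hr, hpr⟩ := hq
  refine ⟨-(γ ^ m • x) + p, mem_iUnion.2 ⟨m, vadd_mem_vadd_set hp⟩, r, hr, ?_⟩
  simp only [add_assoc] at hpr ⊢
  rw [hpr]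
  abel

theorem smul_vadd_eq (h : IsSelfAffineTile γ E F) (s : G) :
    γ • (s +ᵥ F) = (γ • s +ᵥ E) + F := by
  rw [← singleton_vadd, vadd_eq_add, smul_add, smul_set_singleton, h.smul_eq, ← singleton_vadd,
    vadd_eq_add, add_assoc]

section Measure

variable [MeasurableSpace G] [BorelSpace G] {μ : Measure G} [μ.IsAddHaarMeasure] [μ.Regular]

theorem pairwise_aedisjoint_inflationTranslates (h : IsSelfAffineTile γ E F) (hd : d ∈ E)
    (hx : γ • x = d + x) :
    (inflationTranslates γ E x).Pairwise (AEDisjoint μ on (· +ᵥ F)) :=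
  (Set.pairwise_iUnion (inflationLevel_mono hd hx).directed_le).2 fun m =>
    pairwise_aedisjoint_vadd (h.pow m).pairwise_aedisjoint _

end Measure

theorem eq_neg_of_zero_mem_vadd (h : IsSelfAffineTile γ E F) (hγ : IsUniformlyExpanding G γ)
    (hd : d ∈ E) (hx : γ • x = d + x) (hxF : x ∈ interior F) {s : G}
    (hs : s ∈ inflationTranslates γ E x) (h0 : 0 ∈ s +ᵥ F) : s = -x := by
  by_contra hne
  borelize G
  have hdisj : Disjoint (interior (s +ᵥ F)) (interior (-x +ᵥ F)) :=
    disjoint_interior_of_aedisjoint <|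
      h.pairwise_aedisjoint_inflationTranslates (μ := Measure.addHaar) hd hx hs
        neg_mem_inflationTranslates hne
  have h0' : 0 ∈ interior (-x +ᵥ F) := by
    rw [interior_vadd]
    exact ⟨x, hxF, neg_add_cancel x⟩
  refine (hdisj.closure_left isOpen_interior).le_bot ⟨?_, h0'⟩
  rw [interior_vadd, closure_vadd]
  exact vadd_set_mono (h.subset_closure_interior hγ ⟨x, hxF⟩) h0

end IsSelfAffineTile
end SelfAffineTile

theorem relIndex_mul_measure {G : Type*} [AddGroup G] [MeasurableSpace G] [MeasurableAdd G]
    (μ : Measure G) [μ.IsAddLeftInvariant] {H K : AddSubgroup G} (hle : H ≤ K)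
    (hindex : H.relIndex K ≠ 0) (hH : MeasurableSet (H : Set G)) (hK : MeasurableSet (K : Set G)) :
    H.relIndex K * μ H = μ K := by
  have hemb : MeasurableEmbedding K.subtype := .subtype_coe hK
  have : MeasurableAdd K :=
    ⟨fun c => ((measurable_const_add (c : G)).comp measurable_subtype_coe).subtype_mk,
      fun c => ((measurable_add_const (c : G)).comp measurable_subtype_coe).subtype_mk⟩
  have : (H.addSubgroupOf K).FiniteIndex := ⟨hindex⟩
  have : (μ.comap K.subtype).IsAddLeftInvariant := .comap μ hemb
  have hindex_mul := (H.addSubgroupOf K).index_mul_measure (hemb.measurable hH) (μ.comap K.subtype)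
  rwa [hemb.comap_apply, hemb.comap_apply, ← AddSubgroup.coe_map,
    AddSubgroup.map_addSubgroupOf_eq_of_le hle, image_univ, AddSubgroup.coe_subtype,
    Subtype.range_coe] at hindex_mul

theorem relIndex_bFil_succ {A : Matrix (Fin n) (Fin n) ℚ} (hA : IsUnit A.det) (k : ℤ) :
    (bFil A (k + 1)).relIndex (bFil A k) = bIndex A := by
  have hdet : IsUnit (A⁻¹ ^ k).det := (Matrix.isUnit_nonsing_inv_det A hA).det_zpow k
  rw [bFil_succ hA, bFil, AddSubgroup.relIndex_map_map_of_injective _ _ (mulHom_injective hdet),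
    bIndex, aIndex]

theorem bFil_le_laurentLattice {A : Matrix (Fin n) (Fin n) ℚ} (hA : IsUnit A.det) (k : ℤ) :
    bFil A k ≤ laurentLattice A := by
  rintro _ ⟨y, hy, rfl⟩
  rw [Matrix.inv_zpow' hA]
  exact zpow_mem_laurentLattice hA (-k) (polyLattice_inv_le A hA hy)

instance (A : Matrix (Fin n) (Fin n) ℚ) : Countable (ZLaurent A) :=
  inferInstanceAs (Countable (laurentLattice A))

section Scaling

variable (A : Matrix (Fin n) (Fin n) ℚ) [hA : Fact (IsExpanding A)] [hb : Fact (2 ≤ bIndex A)]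

instance : IsUltrametricDist (BSeries A) :=
  IsUltrametricDist.isUltrametricDist_of_forall_norm_add_le_max_norm fun x y => by
    induction x, y using UniformSpace.Completion.induction_on₂ with
    | hp => exact isClosed_le (by fun_prop) (by fun_prop)
    | ih x y =>
      rw [← UniformSpace.Completion.coe_add, UniformSpace.Completion.norm_coe,
        UniformSpace.Completion.norm_coe, UniformSpace.Completion.norm_coe]
      exact bNorm_add_le_max hA.out.isUnit_det hb.out x y

instance : SecondCountableTopology (BSeries A) :=
  UniformSpace.secondCountable_of_separable _

instance : LocallyCompactSpace (BSeries A) :=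
  (isCompact_unitBall A).locallyCompactSpace_of_mem_nhds_of_addGroup
    (Metric.closedBall_mem_nhds 0 one_pos)

instance : (muB A).IsAddHaarMeasure := Measure.isAddHaarMeasure_addHaarMeasure _

instance : (mu A).IsAddHaarMeasure := Measure.prod.instIsAddHaarMeasure _ _

/-- The compact open subgroup `ℤⁿ[[B]]` of `ℤⁿ((B))`. -/
def integers : AddSubgroup (BSeries A) :=
  (IsUltrametricDist.closedBall_openAddSubgroup (BSeries A) one_pos).toAddSubgroup

theorem mem_integers {y : BSeries A} : y ∈ integers A ↔ ‖y‖ ≤ 1 :=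
  mem_closedBall_zero_iff (a := y) (r := 1)

theorem powB_neg_powB (k : ℤ) (y : BSeries A) : powB A (-k) (powB A k y) = y := by
  have h := act_add A (-k) k (0, y)
  rw [neg_add_cancel, act_zero] at h
  exact (congrArg Prod.snd h).symm

theorem mem_map_powB_integers {y : BSeries A} :
    y ∈ (integers A).map (powB A 1) ↔ ‖y‖ ≤ bIndex A := by
  have hb0 : (0 : ℝ) < bIndex A := by exact_mod_cast zero_lt_two.trans_le hb.out
  constructor
  · rintro ⟨z, hz, rfl⟩
    rw [norm_powB, zpow_one]
    exact mul_le_of_le_one_right hb0.le ((mem_integers A).1 hz)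
  · intro hy
    refine ⟨powB A (-1) y, (mem_integers A).2 ?_, ?_⟩
    · rwa [norm_powB, zpow_neg_one, inv_mul_le_one₀ hb0]
    · simpa using powB_neg_powB A (-1) y

theorem integers_le_map_powB : integers A ≤ (integers A).map (powB A 1) := fun y hy =>
  (mem_map_powB_integers A).2 <| ((mem_integers A).1 hy).trans <|
    by exact_mod_cast one_le_two.trans hb.out

theorem map_powB_integers_eq_sup : (integers A).map (powB A 1) =
    ((bFil A (-1)).comap ZLaurent.val).map UniformSpace.Completion.toCompl ⊔ integers A := by
  have hball (z : ZLaurent A) :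
      z.val ∈ bFil A (-1) ↔ (z : BSeries A) ∈ (integers A).map (powB A 1) := by
    rw [mem_map_powB_integers, UniformSpace.Completion.norm_coe,
      ← bNorm_le_iff hA.out.isUnit_det hb.out, neg_neg, zpow_one, norm_def]
  refine le_antisymm (fun y hy => ?_) (sup_le ?_ (integers_le_map_powB A))
  · obtain ⟨z, hz⟩ := UniformSpace.Completion.denseRange_coe.exists_dist_lt y one_pos
    rw [dist_eq_norm] at hz
    have hsub : y - z ∈ integers A := (mem_integers A).2 hz.le
    have hz' : (z : BSeries A) ∈ (integers A).map (powB A 1) := by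
      simpa using sub_mem hy (integers_le_map_powB A hsub)
    exact AddSubgroup.mem_sup.2 ⟨z, ⟨z, (hball z).2 hz', rfl⟩, y - z, hsub, add_sub_cancel _ _⟩
  · rintro _ ⟨z, hz, rfl⟩
    exact (hball z).1 hz

theorem relIndex_integers : (integers A).relIndex ((integers A).map (powB A 1)) = bIndex A := by
  have hcomap : (integers A).comap UniformSpace.Completion.toCompl =
      (bFil A 0).comap ZLaurent.val := by
    ext y
    rw [AddSubgroup.mem_comap, mem_integers, AddSubgroup.mem_comap, ← norm_le_one_iff A]
    exact iff_of_eq (congrArg (· ≤ 1) (UniformSpace.Completion.norm_coe y))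
  have hrange : bFil A (-1) ≤ (ZLaurent.val (A := A)).range :=
    (bFil_le_laurentLattice hA.out.isUnit_det (-1)).trans_eq
      (laurentLattice A).range_subtype.symm
  rw [map_powB_integers_eq_sup, AddSubgroup.relIndex_sup_right, ← AddSubgroup.relIndex_comap,
    hcomap, AddSubgroup.relIndex_comap, AddSubgroup.map_comap_eq_self hrange,
    ← relIndex_bFil_succ hA.out.isUnit_det (-1), neg_add_cancel]

theorem muB_image_closedBall : muB A (powB A 1 '' Metric.closedBall 0 1) = bIndex A := by
  have hone : muB A (integers A) = 1 := Measure.addHaarMeasure_self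
  have hb0 : (integers A).relIndex ((integers A).map (powB A 1)) ≠ 0 := by
    rw [relIndex_integers]; exact (zero_lt_two.trans_le hb.out).ne'
  have hmeas : MeasurableSet ((integers A).map (powB A 1) : Set (BSeries A)) := by
    have : ((integers A).map (powB A 1) : Set (BSeries A)) = Metric.closedBall 0 (bIndex A) :=
      Set.ext fun y => (mem_map_powB_integers A).trans mem_closedBall_zero_iff.symm
    exact this ▸ measurableSet_closedBall
  have h := relIndex_mul_measure (muB A) (integers_le_map_powB A) hb0 measurableSet_closedBall hmeas
  rw [hone, mul_one, relIndex_integers] at h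
  exact h.symm

instance : DistribMulAction (Multiplicative ℤ) (KSpace A) where
  smul k := act A k.toAdd
  one_smul := act_zero A
  mul_smul j k := act_add A j.toAdd k.toAdd
  smul_zero k := map_zero (act A k.toAdd)
  smul_add k := map_add (act A k.toAdd)

theorem ofAdd_smul (k : ℤ) (p : KSpace A) : Multiplicative.ofAdd k • p = act A k p := rfl

instance : ContinuousConstSMul (Multiplicative ℤ) (KSpace A) :=
  ⟨fun k => continuous_act A k.toAdd⟩

theorem distribHaarChar_ofAdd_one :
    distribHaarChar (KSpace A) (Multiplicative.ofAdd (1 : ℤ)) = aIndex A := by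
  let V : Set (EuclideanSpace ℝ (Fin n)) := Metric.closedBall 0 1
  let W : Set (BSeries A) := Metric.closedBall 0 1
  let f := Matrix.toEuclideanLin ((A ^ (1 : ℤ)).map (algebraMap ℚ ℝ))
  have hdet : LinearMap.det f = (A.det : ℝ) := by
    rw [LinearMap.det_toLpLin, zpow_one]
    exact (RingHom.map_det (algebraMap ℚ ℝ) A).symm
  have hindex : ENNReal.ofReal |(A.det : ℝ)| * bIndex A = aIndex A := by
    rw [← ENNReal.ofReal_natCast, ← ENNReal.ofReal_natCast, ← ENNReal.ofReal_mul (abs_nonneg _)]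
    congr 1
    exact_mod_cast (aIndex_eq_abs_det_mul_bIndex hA.out.isUnit_det).symm
  have hW : muB A W = 1 := Measure.addHaarMeasure_self
  have hmu : mu A (V ×ˢ W) = volume V := by rw [mu, Measure.prod_prod, hW, mul_one]
  refine distribHaarChar_eq_of_measure_smul_eq_mul (μ := mu A) (s := V ×ˢ W)
    (hmu ▸ (Metric.measure_closedBall_pos _ _ one_pos).ne')
    (hmu ▸ measure_closedBall_lt_top.ne) ?_
  calc mu A (Multiplicative.ofAdd (1 : ℤ) • V ×ˢ W)
      = mu A ((f '' V) ×ˢ (powB A 1 '' W)) := congrArg (mu A) (Set.prodMap_image_prod f _ V W)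
    _ = ENNReal.ofReal |(A.det : ℝ)| * volume V * bIndex A := by
        rw [mu, Measure.prod_prod, Measure.addHaar_image_linearMap, hdet, muB_image_closedBall]
    _ = (aIndex A : ℝ≥0) * mu A (V ×ˢ W) := by
        rw [mul_right_comm, hindex, hmu, ENNReal.coe_natCast]

end Scaling

theorem blocks_eq_sum (A : Matrix (Fin n) (Fin n) ℚ) (D : Finset (Fin n → ℚ)) (k : ℕ) :
    blocks A D k = ∑ i ∈ Finset.range k, mulHom (A ^ i) '' D := by
  rw [Finset.sum_range]
  ext x
  rw [mem_fintype_sum]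
  constructor
  · rintro ⟨d, hd, rfl⟩
    exact ⟨_, fun i => mem_image_of_mem _ (hd i), rfl⟩
  · rintro ⟨g, hg, rfl⟩
    choose d hd hdg using hg
    exact ⟨d, hd, Finset.sum_congr rfl fun i _ => (hdg i).symm⟩

theorem blocks_eq_image_val {A : Matrix (Fin n) (Fin n) ℚ} [Fact (IsExpanding A)]
    {D : Finset (Fin n → ℚ)} {E : Set (ZLaurent A)} (hE : ZLaurent.val '' E = D) (k : ℕ) :
    blocks A D k = ZLaurent.val '' ∑ i ∈ Finset.range k, powZ A i '' E := by
  rw [blocks_eq_sum, image_finsetSum]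
  refine Finset.sum_congr rfl fun i _ => ?_
  rw [← hE, image_image, image_image]
  simp only [val_powZ, zpow_natCast]

section RepresentationSpace

variable {A : Matrix (Fin n) (Fin n) ℚ} [hA : Fact (IsExpanding A)] [hb : Fact (2 ≤ bIndex A)]

theorem ofAdd_one_pow_smul (k : ℕ) (p : KSpace A) : ofAdd (1 : ℤ) ^ k • p = act A k p := by
  rw [← ofAdd_nsmul, nsmul_one, ofAdd_smul]

theorem inv_ofAdd_one_pow_smul (k : ℕ) (p : KSpace A) :
    (ofAdd (1 : ℤ) ^ k)⁻¹ • p = act A (-k) p := by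
  rw [← ofAdd_nsmul, nsmul_one, ← ofAdd_neg, ofAdd_smul]

theorem norm_inv_pow_smul_le : ∃ C r : ℝ, 0 < C ∧ 0 < r ∧ r < 1 ∧ ∀ (k : ℕ) (p : KSpace A),
    ‖(ofAdd (1 : ℤ) ^ k)⁻¹ • p‖ ≤ C * r ^ k * ‖p‖ := by
  obtain ⟨C, r, hC, hr, hr1, hle⟩ := exists_bound A
  refine ⟨C + 1, max r (1 / 2), by positivity, by positivity, max_lt hr1 (by norm_num),
    fun k p => ?_⟩
  rw [inv_ofAdd_one_pow_smul]
  refine (hle k p).trans ?_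
  gcongr
  · exact le_add_of_nonneg_right zero_le_one
  · exact le_max_left _ _

variable (A) in
theorem isUniformlyExpanding_ofAdd_one :
    IsUniformlyExpanding (KSpace A) (ofAdd (1 : ℤ)) := by
  intro ε hε
  obtain ⟨C, r, -, hr, hr1, hle⟩ := norm_inv_pow_smul_le (A := A)
  have hlim : Tendsto (fun k : ℕ => C * r ^ k) atTop (𝓝 0) := by
    simpa using (tendsto_pow_atTop_nhds_zero_of_lt_one hr.le hr1).const_mul C
  filter_upwards [hlim.eventually_lt_const hε] with k hk p
  exact (hle k p).trans (by gcongr)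

theorem isExpandingLinear_act {k : ℕ} (hk : 1 ≤ k) : IsExpandingLinear (act A (k : ℤ)) where
  continuous := continuous_act A k
  bijective := MulAction.bijective (ofAdd (k : ℤ))
  commutes p := by rw [← act_add, ← act_add, add_comm]
  expands := by
    obtain ⟨C, r, hC, hr, hr1, hle⟩ := norm_inv_pow_smul_le (A := A)
    refine ⟨C⁻¹, r⁻¹, inv_pos.2 hC, (one_lt_inv₀ hr).2 hr1, fun m p q => ?_⟩
    have hiter : (act A (k : ℤ))^[m] = (ofAdd (1 : ℤ) ^ (k * m) • ·) := by
      rw [pow_mul, ← smul_iterate]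
      exact congrArg (·^[m]) (funext fun p => (ofAdd_one_pow_smul k p).symm)
    rw [hiter, dist_eq_norm, dist_eq_norm, ← smul_sub, inv_pow, ← mul_inv, inv_mul_le_iff₀
      (by positivity)]
    calc ‖p - q‖ ≤ C * r ^ (k * m) * ‖ofAdd (1 : ℤ) ^ (k * m) • (p - q)‖ := by
          simpa using hle (k * m) (ofAdd (1 : ℤ) ^ (k * m) • (p - q))
      _ ≤ _ := by
          gcongr ?_ * ?_ * _
          exact pow_le_pow_of_le_one hr.le hr1.le (Nat.le_mul_of_pos_left m hk)

theorem translate_eq_vadd (F : Set (KSpace A)) (s : KSpace A) : translate F s = s +ᵥ F :=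
  image_congr fun p _ => add_comm p s

theorem biUnion_translate (F S : Set (KSpace A)) : ⋃ s ∈ S, translate F s = S + F := by
  simp only [translate_eq_vadd, ← iUnion_add_left_image]
  rfl

theorem isTiling_iff {F S : Set (KSpace A)} :
    IsTiling F S ↔ S + F = univ ∧ S.Pairwise (AEDisjoint (mu A) on (· +ᵥ F)) := by
  rw [← biUnion_translate]
  refine ⟨fun h => ⟨h.covers, fun s hs t ht hst => ?_⟩,
    fun h => ⟨h.1, fun s hs t ht hst => ?_⟩⟩
  · simpa only [translate_eq_vadd] using! h.null_inter s hs t ht hst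
  · simpa only [translate_eq_vadd] using! h.2 hs ht hst

theorem IsTiling.vadd {F S : Set (KSpace A)} (h : IsTiling F S) (c : KSpace A) :
    IsTiling F (c +ᵥ S) := by
  rw [isTiling_iff] at h ⊢
  refine ⟨?_, pairwise_aedisjoint_vadd h.2 c⟩
  rw [vadd_add_assoc, h.1, vadd_set_univ]

variable (A) in
/-- The diagonal embedding `φ : ℤⁿ(B) → 𝕂_A` as a group homomorphism. -/
def phiHom : ZLaurent A →+ KSpace A where
  toFun := phi A
  map_zero' := by
    refine Prod.ext ?_ UniformSpace.Completion.coe_zero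
    ext i
    simp [phi]
  map_add' x y := by
    refine Prod.ext ?_ (UniformSpace.Completion.coe_add x y)
    ext i
    simp [phi]

theorem act_phiHom (k : ℤ) (x : ZLaurent A) : act A k (phiHom A x) = phiHom A (powZ A k x) := by
  refine Prod.ext ?_ (powB_coe A k x)
  ext i
  simp [phiHom, phi, act, val_powZ, mulHom_apply, Matrix.mulVec, dotProduct,
    Matrix.toLpLin_apply]

theorem phiImage_image_val (M : Set (ZLaurent A)) :
    phiImage A (ZLaurent.val '' M) = phiHom A '' M :=
  congrArg (phi A '' ·) (preimage_image_eq M Subtype.val_injective)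

theorem phiHom_image_sum (E : Set (ZLaurent A)) (k : ℕ) :
    phiHom A '' ∑ i ∈ Finset.range k, powZ A i '' E =
      digitSums (ofAdd (1 : ℤ)) (phiHom A '' E) k := by
  rw [digitSums, image_finsetSum]
  refine Finset.sum_congr rfl fun i _ => ?_
  rw [← image_smul, image_image, image_image]
  simp only [ofAdd_one_pow_smul, act_phiHom]

variable {D : Finset (Fin n → ℚ)} (hD : IsDigitSet A D)
include hD

theorem IsDigitSet.delta_eq_iUnion :
    delta A D = ⋃ k ≥ 1, (digitSums (ofAdd (1 : ℤ)) (phiImage A D) k -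
      digitSums (ofAdd (1 : ℤ)) (phiImage A D) k) := by
  have hsub : (D : Set (Fin n → ℚ)) ⊆ laurentLattice A := fun d hd =>
    polyLattice_le A (hD.mem_polyLattice d hd)
  obtain ⟨E, hE⟩ : ∃ E : Set (ZLaurent A), ZLaurent.val '' E = D :=
    subset_range_iff_exists_image_eq.1 (hsub.trans_eq Subtype.range_val.symm)
  refine iUnion₂_congr fun k _ => ?_
  rw [blocks_eq_image_val hE, ← image_sub, phiImage_image_val, image_sub, phiHom_image_sum, ← hE,
    phiImage_image_val]

theorem isSelfAffineTile_tile :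
    IsSelfAffineTile (ofAdd (1 : ℤ)) (phiImage A D) (tile hD) := by
  have hinj : InjOn ZLaurent.val (ZLaurent.val (A := A) ⁻¹' D) := Subtype.val_injective.injOn
  have hfin : (ZLaurent.val (A := A) ⁻¹' D).Finite := D.finite_toSet.preimage hinj
  refine ⟨hfin.image _, ?_, (tile_spec hD).2.1, (tile_spec hD).2.2.trans (biUnion_translate _ _)⟩
  rw [distribHaarChar_ofAdd_one, ← hD.card_eq, Nat.cast_le, ← ncard_coe_finset]
  exact (ncard_image_le hfin).trans (ncard_le_ncard_of_injOn _ (fun _ => id) hinj D.finite_toSet)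

theorem isTiling_delta {S : Set (KSpace A)} (hS : IsTiling (tile hD) S) (hSD : S ⊆ delta A D)
    {H : AddSubgroup (KSpace A)} (hH : (H : Set (KSpace A)) = delta A D) :
    IsTiling (tile hD) (delta A D) := by
  refine isTiling_iff.2 ⟨?_, fun s hs t ht hst => ?_⟩
  · exact univ_subset_iff.1 ((isTiling_iff.1 hS).1.ge.trans (add_subset_add_right hSD))
  · have hsub : s - t ∈ delta A D := hH ▸ H.sub_mem (hH.ge hs) (hH.ge ht)
    rw [hD.delta_eq_iUnion] at hsub
    obtain ⟨k, -, hk⟩ := mem_iUnion₂.1 hsub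
    exact aedisjoint_vadd_of_sub_mem_sub
      ((isSelfAffineTile_tile hD).pow k).pairwise_aedisjoint hk hst

variable {k : ℕ} {d x : KSpace A}
  (hd : d ∈ digitSums (ofAdd (1 : ℤ)) (phiImage A D) k)
  (hx : ofAdd (1 : ℤ) ^ k • x = d + x)
include hd hx

theorem vadd_inflationTranslates_subset_delta (hk : 1 ≤ k) :
    x +ᵥ inflationTranslates (ofAdd (1 : ℤ) ^ k)
      (digitSums (ofAdd (1 : ℤ)) (phiImage A D) k) x ⊆ delta A D := by
  refine (vadd_inflationTranslates_subset hd hx).trans (iUnion₂_subset fun m hm => ?_)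
  rw [digitSums_pow, hD.delta_eq_iUnion]
  exact subset_iUnion₂_of_subset (k * m) (Nat.mul_pos hk hm) subset_rfl

theorem isAtomicSelfReplicating_inflationTranslates (hk : 1 ≤ k) (hxF : x ∈ interior (tile hD)) :
    IsAtomicSelfReplicating (act A (k : ℤ)) (tile hD)
      (inflationTranslates (ofAdd (1 : ℤ) ^ k)
        (digitSums (ofAdd (1 : ℤ)) (phiImage A D) k) x) := by
  have htile := (isSelfAffineTile_tile hD).pow k
  have hexpand := (isUniformlyExpanding_ofAdd_one A).pow hk
  refine ⟨⟨isTiling_iff.2 ⟨htile.inflationTranslates_add_eq_univ hexpand hxF,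
    htile.pairwise_aedisjoint_inflationTranslates hd hx⟩, isExpandingLinear_act hk,
    fun s hs => ⟨_, smul_vadd_subset_inflationTranslates hs, htile.finite.vadd_set, ?_⟩⟩,
    -x, ⟨neg_mem_inflationTranslates, ?_⟩, fun s hs => ?_⟩
  · rw [biUnion_translate, ← htile.smul_vadd_eq, translate_eq_vadd]
    exact image_congr fun p _ => (ofAdd_one_pow_smul k p).symm
  · rw [translate_eq_vadd]
    exact ⟨x, interior_subset hxF, neg_add_cancel x⟩
  · exact htile.eq_neg_of_zero_mem_vadd hexpand hd hx hxF hs.1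
      (translate_eq_vadd (tile hD) s ▸ hs.2)

end RepresentationSpace

end RationalTile

end

theorem mainTheorem4 {n : ℕ} (A : Matrix (Fin n) (Fin n) ℚ)
    [Fact (RationalTile.IsExpanding A)] [Fact (2 ≤ RationalTile.bIndex A)]
    (D : Finset (Fin n → ℚ)) (hD : RationalTile.IsDigitSet A D)
    (hF : ∃ U ⊆ RationalTile.tile hD, IsOpen U ∧ U.Nonempty) :
    (∃ S ⊆ RationalTile.delta A D, RationalTile.IsTiling (RationalTile.tile hD) S ∧
      ∃ t : RationalTile.KSpace A, ∃ k : ℕ, 1 ≤ k ∧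
        RationalTile.IsAtomicSelfReplicating (RationalTile.act A (k : ℤ))
          (RationalTile.tile hD) ((fun s => s + t) '' S)) ∧
    ((∃ H : AddSubgroup (RationalTile.KSpace A),
        (H : Set (RationalTile.KSpace A)) = RationalTile.delta A D) →
      RationalTile.IsTiling (RationalTile.tile hD) (RationalTile.delta A D)) := by
  obtain ⟨U, hUF, hUo, hUne⟩ := hF
  obtain ⟨k, hk, d, hd, x, hxF, hx⟩ :=
    (RationalTile.isSelfAffineTile_tile hD).exists_periodic_mem_interior
      (RationalTile.isUniformlyExpanding_ofAdd_one A) (hUne.mono (interior_maximal hUF hUo))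
  have hatomic := RationalTile.isAtomicSelfReplicating_inflationTranslates hD hd hx hk hxF
  have hdelta := RationalTile.vadd_inflationTranslates_subset_delta hD hd hx hk
  have htiling := hatomic.isTiling.vadd x
  refine ⟨⟨_, hdelta, htiling, -x, k, hk, ?_⟩, ?_⟩
  · rw [← RationalTile.translate, RationalTile.translate_eq_vadd, neg_vadd_vadd]
    exact hatomic
  · rintro ⟨H, hH⟩
    exact RationalTile.isTiling_delta hD htiling hdelta hH
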